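/- **Setting.** Let $\Omega\subset\mathbb C^n$ be a pseudoconvex domain with $C^2$-smooth boundary $b\Omega$, let $z_0\in b\Omega$, and write $\delta_\Omega(z)$ for the Euclidean distance from $z$ to $b\Omega$. Let $f:[1,\infty)\to[1,\infty)$ be smooth and increasing with $f(t)\le t^{1/2}$ and $\int_t^\infty\frac{da}{a f(a)}<\infty$ for some $t>1$. Put $g(t)=\big(\int_t^\infty\frac{da}{af(a)}\big)^{-1}$ for $t\ge1$, let $g^*:[g(1),\infty)\to[1,\infty)$ be the inverse function of $g$, fix $\gamma>0$, and set $G(0)=0$ and $G(\delta)=\big(g^*(\gamma\delta^{-1})\big)^{-1}$ for $0<\delta\le\gamma/g(1)$. A projection of $z$ to $b\Omega$ is a point $p\in b\Omega$ with $|z-p|=\delta_\Omega(z)$. **Hypothesis (family of bumping functions).** Let $U$ be an open neighborhood of $z_0$ and $\rho:U\times(U\cap b\Omega)\to\mathbb R$ a $C^2$ function such that, with positive constants $c_0,C_0$ independent of the points, 1. $\rho(w,w)=0$ for $w\in U\cap b\Omega$; 2. $\rho(z,w)\le -G(|z-w|)$ for $z\in U\cap\Omega$ and $w\in U\cap b\Omega$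 (wherever $G(|z-w|)$ is defined); 3. $\rho(z,p)\ge -C_0\,\delta_\Omega(z)$ for $z\in U\cap\Omega$ and every projection $p\in U$ of $z$ to $b\Omega$; 4. for each $w\in U\cap b\Omega$ the set $S_w=\{z\in U:\rho(z,w)=0\}$ satisfies: (a) $c_0\le|D_z\rho(z,w)|\le C_0$ for all $z\in S_w$; (b) $S_w$ is pseudoconvex, i.e. $\sum_{j,k}\frac{\partial^2\rho}{\partial z_j\partial\bar z_k}(z,w)X_j\overline{X_k}\ge0$ whenever $z\in S_w$ and $\sum_j\frac{\partial\rho}{\partial z_j}(z,w)X_j=0$; (c) $S_w\cap\overline\Omega=\{w\}$. **Theorem 3.1.** Fix $0<\eta<1$. Then there are an open neighborhood $V\subset U$ of $z_0$, a constant $C>0$, and for every $w\in V\cap b\Omega$ a real-valued function $\psi_w$, such that $G(|z-w|)$ is defined for all $z,w\in V$ and, for every $w\in V\cap b\Omega$, one has $(V\cap\overline\Omega)\setminus\{w\}\subset\{z\in V:\rho(z,w)<0\}$, the function $\psi_w$ is plurisubharmonic on the open set $\{z\in V:\rho(z,w)<0\}$, and 1. $|\psi_w(z)-\psi_w(z')|\le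 C|z-z'|^\eta$ for all $z,z'\in V\cap\overline\Omega$; 2. $\psi_w(z)\le -G(|z-w|)^\eta$ for all $z\in V\cap\overline\Omega$. Moreover, 3. for every $z\in V\cap\overline\Omega$, every projection $p$ of $z$ to $b\Omega$ lies in $V$ and satisfies $\psi_p(z)\ge -C\,\delta_\Omega(z)^\eta$. -/

import Mathlib

open scoped ContDiff

/-- Complex Euclidean space `ℂⁿ` with its Euclidean norm. -/
abbrev CSpace (n : ℕ) : Type := EuclideanSpace ℂ (Fin n)

/-- The distance `δ_Ω(z)` from `z` to the boundary of `Ω`. -/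
noncomputable def boundaryDist {n : ℕ} (Ω : Set (CSpace n)) (z : CSpace n) : ℝ :=
  Metric.infDist z (frontier Ω)

/-- `p` is a projection of `z` to the boundary of `Ω`: a boundary point nearest to `z`. -/
def IsBoundaryProj {n : ℕ} (Ω : Set (CSpace n)) (z p : CSpace n) : Prop :=
  p ∈ frontier Ω ∧ dist z p = boundaryDist Ω z

/-- The Levi form `∂∂̄u(X, X̄) = ∑ (∂²u/∂z_j∂z̄_k) X_j X̄_k` of a real function `u` at `z`,
written through the real second derivative as `(D²u(X, X) + D²u(iX, iX)) / 4`. -/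
noncomputable def leviForm {n : ℕ} (u : CSpace n → ℝ) (z X : CSpace n) : ℝ :=
  (fderiv ℝ (fderiv ℝ u) z X X
    + fderiv ℝ (fderiv ℝ u) z (Complex.I • X) (Complex.I • X)) / 4

/-- `X` is a complex tangent vector at `z` to the level set of `u` through `z`:
`∂u(X) = ∑ (∂u/∂z_j) X_j = 0`, i.e. `Du(X) = 0` and `Du(iX) = 0`. -/
def IsComplexTangent {n : ℕ} (u : CSpace n → ℝ) (z X : CSpace n) : Prop :=
  fderiv ℝ u z X = 0 ∧ fderiv ℝ u z (Complex.I • X) = 0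

/-- The hypersurface `{z ∈ W : u z = 0}` is (Levi) pseudoconvex, seen from the side `u < 0`. -/
def LeviPseudoconvexZeroSet {n : ℕ} (u : CSpace n → ℝ) (W : Set (CSpace n)) : Prop :=
  ∀ z ∈ W, u z = 0 → ∀ X, IsComplexTangent u z X → 0 ≤ leviForm u z X

/-- `Ω` is a pseudoconvex domain (connected open set) in `ℂⁿ` with `C²`-smooth boundary:
near every boundary point, `Ω` is `{r < 0}` and its boundary is `{r = 0}` for a `C²` function `r`
with `dr ≠ 0` on `{r = 0}`, whose Levi form is nonnegative on the complex tangent vectors of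
the boundary. -/
structure IsPseudoconvexC2Domain {n : ℕ} (Ω : Set (CSpace n)) : Prop where
  isOpen : IsOpen Ω
  isConnected : IsConnected Ω
  boundary : ∀ p ∈ frontier Ω, ∃ (W : Set (CSpace n)) (r : CSpace n → ℝ),
    IsOpen W ∧ p ∈ W ∧ ContDiffOn ℝ 2 r W ∧
    (∀ z ∈ W, r z = 0 → fderiv ℝ r z ≠ 0) ∧
    (∀ z ∈ W, z ∈ Ω ↔ r z < 0) ∧
    (∀ z ∈ W, z ∈ frontier Ω ↔ r z = 0) ∧
    LeviPseudoconvexZeroSet r W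

/-- A real-valued function `u` is plurisubharmonic on (the open set) `D`: it is upper
semicontinuous on `D`, and it satisfies the sub-mean value inequality on every closed affine
complex disc `{a + ζ b : |ζ| ≤ 1}` contained in `D`. (As `u a > -∞`, the mean over the circle
is then finite, that is, `u` is integrable over the circle; this is recorded explicitly.) -/
def IsPlurisubharmonicOn {n : ℕ} (u : CSpace n → ℝ) (D : Set (CSpace n)) : Prop :=
  UpperSemicontinuousOn u D ∧
  ∀ a b : CSpace n, (∀ ζ : ℂ, ‖ζ‖ ≤ 1 → a + ζ • b ∈ D) →
    CircleIntegrable (fun ζ : ℂ => u (a + ζ • b)) 0 1 ∧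
    u a ≤ Real.circleAverage (fun ζ : ℂ => u (a + ζ • b)) 0 1

/-- The functions `f : [1, ∞) → [1, ∞)` under consideration: smooth, increasing, `f(t) ≤ t^{1/2}`,
and `∫_t^∞ da / (a f(a)) < ∞` for some `t > 1`. -/
structure IsRateFunction (f : ℝ → ℝ) : Prop where
  smooth : ContDiffOn ℝ ∞ f (Set.Ici 1)
  mono : MonotoneOn f (Set.Ici 1)
  one_le : ∀ t, 1 ≤ t → 1 ≤ f t
  le_sqrt : ∀ t, 1 ≤ t → f t ≤ t ^ (1 / 2 : ℝ)
  integrable : ∃ t, 1 < t ∧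
    MeasureTheory.IntegrableOn (fun a : ℝ => 1 / (a * f a)) (Set.Ioi t)

/-- `g(t) = (∫_t^∞ da / (a f(a)))⁻¹`. -/
noncomputable def gRate (f : ℝ → ℝ) (t : ℝ) : ℝ :=
  (∫ a in Set.Ioi t, 1 / (a * f a))⁻¹

/-- The inverse function `g* : [g(1), ∞) → [1, ∞)` of `g : [1, ∞) → [g(1), ∞)`. -/
noncomputable def gInv (f : ℝ → ℝ) : ℝ → ℝ :=
  Function.invFunOn (gRate f) (Set.Ici 1)

/-- `G(δ) = (g*(γ δ⁻¹))⁻¹` for `δ > 0`, and `G(0) = 0`. -/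
noncomputable def bumpG (f : ℝ → ℝ) (γ δ : ℝ) : ℝ :=
  if δ = 0 then 0 else (gInv f (γ * δ⁻¹))⁻¹

/-- The domain `0 ≤ δ ≤ γ / g(1)` of the function `G`. -/
def InDomG (f : ℝ → ℝ) (γ δ : ℝ) : Prop :=
  0 ≤ δ ∧ δ * gRate f 1 ≤ γ

/-- `ρ : U × (U ∩ bΩ) → ℝ` is a family of bumping functions for `Ω` near `z₀`, with rate `G`.
The constants hidden in `≳` and `≈` do not depend on the points. -/
structure IsBumpingFamily {n : ℕ} (Ω : Set (CSpace n)) (z₀ : CSpace n) (f : ℝ → ℝ) (γ : ℝ)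
    (U : Set (CSpace n)) (ρ : CSpace n → CSpace n → ℝ) : Prop where
  isOpen : IsOpen U
  mem : z₀ ∈ U
  contDiff : ContDiffOn ℝ 2 (fun p : CSpace n × CSpace n => ρ p.1 p.2) (U ×ˢ (U ∩ frontier Ω))
  diag : ∀ w ∈ U ∩ frontier Ω, ρ w w = 0
  upper : ∀ z ∈ U ∩ Ω, ∀ w ∈ U ∩ frontier Ω, InDomG f γ (dist z w) →
    ρ z w ≤ -bumpG f γ (dist z w)
  lower : ∃ C : ℝ, 0 < C ∧ ∀ z ∈ U ∩ Ω, ∀ p ∈ U, IsBoundaryProj Ω z p →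
    -(C * boundaryDist Ω z) ≤ ρ z p
  grad : ∃ c C : ℝ, 0 < c ∧ 0 < C ∧ ∀ w ∈ U ∩ frontier Ω, ∀ z ∈ U, ρ z w = 0 →
    c ≤ ‖fderiv ℝ (fun ζ => ρ ζ w) z‖ ∧ ‖fderiv ℝ (fun ζ => ρ ζ w) z‖ ≤ C
  pseudoconvex : ∀ w ∈ U ∩ frontier Ω, LeviPseudoconvexZeroSet (fun z => ρ z w) U
  touch : ∀ w ∈ U ∩ frontier Ω, ∀ z ∈ U ∩ closure Ω, ρ z w = 0 → z = w

/-! Near `z₀` a single direction `ν` crosses all the hypersurfaces `S_w` at uniform speed, because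
the family is `C²` and its gradient does not vanish at `(z₀, z₀)`. Let `d_w(z)` measure, in
multiples of `ν`, how far `z` must move along `ν` to reach `S_w`. This depth is Lipschitz, uniformly
in `w`, and comparable to `-ρ(z, w)` where `ρ ≤ 0`. The function sought is `ψ_w = -K (d_w e^{-L|z -
z₀|²})^η`: the Hölder bound is the Lipschitz bound raised to the power `η`, and the two size
estimates are the bounds on `ρ` transferred to `d_w`.

Plurisubharmonicity is the Diederich–Fornæss argument for the pseudoconvex side of `S_w`. The Levi
form of `S_w` is nonnegative only on complex tangent vectors, so in a general direction there is an
error linear in the normal component (`neg_le_levi_projection`). The exponent `η < 1` leaves a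
multiple `1 - η` of the squared logarithmic derivative of `d_w`, and this together with the Levi
form of the weight absorbs the error (`weighted_log_laplacian_neg`). The ball is chosen after `L`,
so the gradient of the weight is harmless for every `η < 1`.

No second-order regularity of `d_w` is needed. A parabola in the direction `ν` that stays where `ρ ≥
0` bounds `d_w` from above by a quadratic polynomial (`eventually_depthAlong_le_quadratic`), so
`ψ_w` has lower support functions of positive Laplacian. By the maximum principle these suffice for
the sub-mean value inequality (`le_circleAverage_of_lower_support`). -/

open Filter Topology Metric MeasureTheory

/-! ### Sub-mean value inequality from lower support functions -/

/-- A function with positive second derivative at `0` has no local maximum there. -/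
lemma not_isLocalMax_of_second_deriv_pos {F F' : ℝ → ℝ} {c : ℝ}
    (h1 : ∀ᶠ t in 𝓝 0, HasDerivAt F (F' t) t) (h2 : HasDerivAt F' c 0) (hc : 0 < c) :
    ¬ IsLocalMax F 0 := by
  intro hmax
  have hd : deriv F =ᶠ[𝓝 0] F' := h1.mono fun t ht => ht.deriv
  have hdd : deriv (deriv F) 0 = c := by rw [hd.deriv_eq, h2.deriv]
  have hmin : IsLocalMin F 0 :=
    isLocalMin_of_deriv_deriv_pos (by rw [hdd]; exact hc) hmax.deriv_eq_zero
      h1.self_of_nhds.continuousAt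
  -- A point that is both a local maximum and a local minimum forces local constancy, hence second
  -- derivative zero.
  have hconst : F =ᶠ[𝓝 0] fun _ => F 0 := by
    filter_upwards [hmax, hmin] with t ha hb using le_antisymm ha hb
  have : deriv F =ᶠ[𝓝 0] fun _ => (0 : ℝ) := by
    simpa using hconst.deriv
  have h0 : deriv (deriv F) 0 = 0 := by simpa using this.deriv_eq
  linarith

/-- A continuous function on the unit circle is uniformly close to the real part of a polynomial. -/
lemma exists_polynomial_re_near {u : ℂ → ℝ} (hu : ContinuousOn u (sphere 0 1)) {ε : ℝ}
    (hε : 0 < ε) : ∃ P : Polynomial ℂ, ∀ ζ ∈ sphere (0 : ℂ) 1, |u ζ - (P.eval ζ).re| < ε := by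
  have : Fact (0 < 2 * Real.pi) := ⟨by positivity⟩
  have hc : Continuous fun x : AddCircle (2 * Real.pi) => (u (AddCircle.toCircle x : ℂ) : ℂ) := by
    refine Complex.continuous_ofReal.comp ?_
    refine hu.comp_continuous (continuous_subtype_val.comp AddCircle.continuous_toCircle) ?_
    intro x; simpa using Circle.norm_coe (AddCircle.toCircle x)
  let F : C(AddCircle (2 * Real.pi), ℂ) := ⟨_, hc⟩
  have hF : F ∈ (Submodule.span ℂ (Set.range <| @fourier (2 * Real.pi))).topologicalClosure := by
    rw [span_fourier_closure_eq_top]; trivial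
  obtain ⟨T, hT, hTF⟩ := Metric.mem_closure_iff.1 hF ε hε
  -- On the circle a negative power of `ζ` is the conjugate of a positive one.
  have key : ∃ P Q : Polynomial ℂ, ∀ x : AddCircle (2 * Real.pi),
      T x = P.eval (AddCircle.toCircle x : ℂ)
        + (starRingEnd ℂ) (Q.eval (AddCircle.toCircle x : ℂ)) := by
    refine Submodule.span_induction (p := fun T _ => ∃ P Q : Polynomial ℂ,
      ∀ x : AddCircle (2 * Real.pi), T x = P.eval (AddCircle.toCircle x : ℂ)
        + (starRingEnd ℂ) (Q.eval (AddCircle.toCircle x : ℂ))) ?_ ?_ ?_ ?_ hT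
    · rintro _ ⟨n, rfl⟩
      obtain ⟨m, rfl | rfl⟩ := n.eq_nat_or_neg
      · exact ⟨Polynomial.X ^ m, 0, fun x => by simp [fourier_apply, AddCircle.toCircle_nsmul]⟩
      · refine ⟨0, Polynomial.X ^ m, fun x => ?_⟩
        rw [fourier_neg]
        simp [fourier_apply, AddCircle.toCircle_nsmul]
    · exact ⟨0, 0, fun x => by simp⟩
    · rintro x y - - ⟨P, Q, h⟩ ⟨P', Q', h'⟩
      refine ⟨P + P', Q + Q', fun z => ?_⟩
      simp [h, h']; ring
    · rintro c x - ⟨P, Q, h⟩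
      refine ⟨Polynomial.C c * P, Polynomial.C ((starRingEnd ℂ) c) * Q, fun z => ?_⟩
      simp [h]; ring
  obtain ⟨P, Q, hPQ⟩ := key
  -- Conjugating `Q` does not change its real part, so `P + Q` has the real part of `T`.
  refine ⟨P + Q, fun ζ hζ => ?_⟩
  have hζ1 : ‖ζ‖ = 1 := by simpa using hζ
  obtain ⟨x, hx⟩ : ∃ x : AddCircle (2 * Real.pi), (AddCircle.toCircle x : ℂ) = ζ := by
    refine ⟨((Complex.arg ζ : ℝ) : AddCircle (2 * Real.pi)), ?_⟩
    rw [AddCircle.toCircle_apply_mk, Circle.coe_exp]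
    have := Complex.norm_mul_exp_arg_mul_I ζ
    rw [hζ1] at this
    rw [show (2 * Real.pi / (2 * Real.pi) * ζ.arg : ℝ) = ζ.arg by field_simp]
    simpa using this
  have h1 : ‖F x - T x‖ < ε := by
    rw [← dist_eq_norm]; exact (ContinuousMap.dist_apply_le_dist x).trans_lt hTF
  have h2 : u ζ - ((P + Q).eval ζ).re = (F x - T x).re := by
    simp [F, hPQ, hx]
  rw [h2]
  exact (Complex.abs_re_le_norm _).trans_lt h1

/-- Sub-mean value inequality on the unit disc for a continuous function that has, at every
interior point, lower support functions of positive Laplacian. -/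
theorem le_circleAverage_of_lower_support {u : ℂ → ℝ} (hu : ContinuousOn u (closedBall 0 1))
    (h : ∀ a ∈ ball (0 : ℂ) 1, ∃ (v v' : ℝ → ℝ) (c : ℝ), 0 < c ∧
      (∀ᶠ t in 𝓝 0, HasDerivAt v (v' t) t) ∧ HasDerivAt v' c 0 ∧ v 0 = 2 * u a ∧
      ∀ᶠ t : ℝ in 𝓝 0, v t ≤ u (a + t) + u (a + t * Complex.I)) :
    u 0 ≤ Real.circleAverage u 0 1 := by
  refine le_of_forall_pos_le_add fun ε hε => ?_
  obtain ⟨P, hP⟩ := exists_polynomial_re_near (hu.mono sphere_subset_closedBall) (half_pos hε)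
  have hPc : Continuous fun ζ : ℂ => (P.eval ζ).re := by fun_prop
  have hcont : ContinuousOn (fun ζ => u ζ - (P.eval ζ).re) (closedBall 0 1) :=
    hu.sub hPc.continuousOn
  obtain ⟨a, ha, hmax⟩ := (isCompact_closedBall (0 : ℂ) 1).exists_isMaxOn
    ⟨0, by simp⟩ hcont
  -- At an interior maximum of `u - Re P`, the support function minus the two values of `Re P` would
  -- have a local maximum with positive second derivative.
  have has : a ∈ sphere (0 : ℂ) 1 := by
    by_contra hns
    have hab : a ∈ ball (0 : ℂ) 1 := by
      simp only [mem_closedBall, mem_sphere, mem_ball] at *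
      exact lt_of_le_of_ne ha hns
    obtain ⟨v, v', c, hc, hv, hv', hv0, hle⟩ := h a hab
    have hpoly : ∀ (Q : Polynomial ℂ) (e : ℂ) (t : ℝ),
        HasDerivAt (fun t : ℝ => (Q.eval (a + t * e)).re)
          ((Q.derivative.eval (a + t * e) * e).re) t := by
      intro Q e t
      have h1 : HasDerivAt (fun t : ℝ => a + t * e) e t := by
        simpa using ((Complex.ofRealCLM.hasDerivAt (x := t)).mul_const e).const_add a
      exact Complex.reCLM.hasFDerivAt.comp_hasDerivAt t
        ((Q.hasDerivAt (a + t * e)).comp t h1)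
    have hpoly2 : ∀ (Q : Polynomial ℂ) (e : ℂ) (t : ℝ),
        HasDerivAt (fun t : ℝ => (Q.eval (a + t * e) * e).re)
          ((Q.derivative.eval (a + t * e) * e * e).re) t := by
      intro Q e t
      simpa [mul_assoc, mul_comm, mul_left_comm] using hpoly (Polynomial.C e * Q) e t
    have hlm : IsLocalMax (fun t : ℝ => v t - ((P.eval (a + t * 1)).re
        + (P.eval (a + t * Complex.I)).re)) 0 := by
      have hmem : ∀ e : ℂ, ∀ᶠ t : ℝ in 𝓝 0, a + t * e ∈ closedBall (0 : ℂ) 1 := by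
        intro e
        have hct : ContinuousAt (fun t : ℝ => a + t * e) 0 := by fun_prop
        have := hct.eventually (isOpen_ball.mem_nhds (show a + ((0 : ℝ) : ℂ) * e ∈ ball 0 1 by
          simpa using hab))
        exact this.mono fun t ht => ball_subset_closedBall ht
      filter_upwards [hle, hmem 1, hmem Complex.I] with t h1 h2 h3
      have e2 := hmax h2
      have e3 := hmax h3
      simp only [Set.mem_ofPred_eq] at e2 e3
      simp only [hv0, Complex.ofReal_zero, zero_mul, add_zero, mul_one] at *
      linarith
    refine not_isLocalMax_of_second_deriv_pos (c := c) (F' := fun t => v' t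
        - ((P.derivative.eval (a + t * 1) * 1).re
          + (P.derivative.eval (a + t * Complex.I) * Complex.I).re)) ?_ ?_ hc hlm
    · filter_upwards [hv] with t ht
      exact ht.sub ((hpoly P 1 t).add (hpoly P Complex.I t))
    -- Harmonicity of `Re P`: its second derivatives in the directions `1` and `i` cancel, and only
    -- `c` remains.
    · exact (hv'.sub ((hpoly2 P.derivative 1 0).add (hpoly2 P.derivative Complex.I 0))).congr_deriv
        (by simp [mul_assoc])
  have hu_int : CircleIntegrable u 0 1 :=
    (hu.mono sphere_subset_closedBall).circleIntegrable zero_le_one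
  have hP_int : CircleIntegrable (fun ζ => (P.eval ζ).re) 0 1 :=
    hPc.continuousOn.circleIntegrable zero_le_one
  have hPavg : Real.circleAverage (fun ζ => (P.eval ζ).re) 0 1 = (P.eval 0).re :=
    InnerProductSpace.HarmonicOnNhd.circleAverage_eq fun x _ =>
      (P.differentiable.analyticAt x).harmonicAt_re
  have hmono : Real.circleAverage (fun ζ => (P.eval ζ).re - ε / 2) 0 1
      ≤ Real.circleAverage u 0 1 := by
    refine Real.circleAverage_mono (hP_int.sub (circleIntegrable_const _ _ _)) hu_int ?_
    intro ζ hζ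
    have := abs_lt.1 (hP ζ (by simpa using hζ))
    linarith [this.1]
  have hsub : Real.circleAverage (fun ζ => (P.eval ζ).re - ε / 2) 0 1
      = (P.eval 0).re - ε / 2 := by
    rw [← hPavg]
    refine (Real.circleAverage_fun_sub hP_int (circleIntegrable_const (ε / 2) 0 1)).trans ?_
    rw [Real.circleAverage_const]
  -- The maximum lies on the circle, so `u - Re P < ε/2` at the centre too; replacing `Re P` by `u`
  -- in the mean costs the other `ε/2`.
  have h0 := hmax (show (0 : ℂ) ∈ closedBall 0 1 by simp)
  simp only [Set.mem_ofPred_eq] at h0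
  have := abs_lt.1 (hP a has)
  linarith [this.2]

/-! ### The functions `g`, `g*` and `G` -/

namespace IsRateFunction

variable {f : ℝ → ℝ}

lemma integrand_pos (hf : IsRateFunction f) {a : ℝ} (ha : 1 ≤ a) : 0 < 1 / (a * f a) := by
  have := hf.one_le a ha
  positivity

lemma integrableOn_Ioi_one (hf : IsRateFunction f) :
    IntegrableOn (fun a : ℝ => 1 / (a * f a)) (Set.Ioi 1) := by
  obtain ⟨t, ht, hint⟩ := hf.integrable
  have hc : ContinuousOn (fun a : ℝ => 1 / (a * f a)) (Set.Icc 1 t) := by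
    refine continuousOn_const.div (continuousOn_id.mul
      (hf.smooth.continuousOn.mono Set.Icc_subset_Ici_self)) fun a ha => ?_
    have := hf.integrand_pos ha.1
    exact fun h => by simp [h] at this
  have := (hc.integrableOn_Icc.mono_set Set.Ioc_subset_Icc_self).union hint
  rwa [Set.Ioc_union_Ioi_eq_Ioi ht.le] at this

lemma tail_sub (hf : IsRateFunction f) {s t : ℝ} (hs : 1 ≤ s) (hst : s ≤ t) :
    (∫ a in Set.Ioi s, 1 / (a * f a)) - ∫ a in Set.Ioi t, 1 / (a * f a)
      = ∫ a in s..t, 1 / (a * f a) :=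
  intervalIntegral.integral_Ioi_sub_Ioi (hf.integrableOn_Ioi_one.mono_set (Set.Ioi_subset_Ioi hs)) hst

lemma tail_strictAntiOn (hf : IsRateFunction f) :
    StrictAntiOn (fun t => ∫ a in Set.Ioi t, 1 / (a * f a)) (Set.Ici 1) := by
  intro s hs t _ hst
  have hs : 1 ≤ s := hs
  have h1 := hf.tail_sub hs hst.le
  have h2 : 0 < ∫ a in s..t, 1 / (a * f a) := by
    refine intervalIntegral.intervalIntegral_pos_of_pos_on ?_ ?_ hst
    · refine (intervalIntegrable_iff_integrableOn_Ioc_of_le hst.le).2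
        (hf.integrableOn_Ioi_one.mono_set ?_)
      exact fun x hx => lt_of_le_of_lt hs hx.1
    · exact fun x hx => hf.integrand_pos (hs.trans hx.1.le)
  simp only
  linarith

lemma tail_tendsto (hf : IsRateFunction f) :
    Tendsto (fun t => ∫ a in Set.Ioi t, 1 / (a * f a)) atTop (𝓝 0) := by
  have h := intervalIntegral_tendsto_integral_Ioi 1 hf.integrableOn_Ioi_one tendsto_id
  have h2 : Tendsto (fun t => (∫ a in Set.Ioi 1, 1 / (a * f a)) - ∫ a in (1 : ℝ)..t, 1 / (a * f a))
      atTop (𝓝 0) := by simpa using h.const_sub (∫ a in Set.Ioi 1, 1 / (a * f a))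
  refine h2.congr' ?_
  filter_upwards [eventually_ge_atTop 1] with t ht
  rw [← hf.tail_sub le_rfl ht]; ring

lemma tail_pos (hf : IsRateFunction f) {t : ℝ} (ht : 1 ≤ t) :
    0 < ∫ a in Set.Ioi t, 1 / (a * f a) := by
  have h1 : (∫ a in Set.Ioi (t + 1), 1 / (a * f a)) < ∫ a in Set.Ioi t, 1 / (a * f a) :=
    hf.tail_strictAntiOn ht (show (1 : ℝ) ≤ t + 1 by linarith) (by linarith)
  have h2 : 0 ≤ ∫ a in Set.Ioi (t + 1), 1 / (a * f a) :=
    setIntegral_nonneg measurableSet_Ioi fun x hx =>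
      (hf.integrand_pos (by have : t + 1 < x := hx; linarith)).le
  linarith

lemma gRate_pos (hf : IsRateFunction f) {t : ℝ} (ht : 1 ≤ t) : 0 < gRate f t :=
  inv_pos.2 (hf.tail_pos ht)

lemma gRate_strictMonoOn (hf : IsRateFunction f) : StrictMonoOn (gRate f) (Set.Ici 1) :=
  fun _ hs _ ht hst => inv_strictAnti₀ (hf.tail_pos ht) (hf.tail_strictAntiOn hs ht hst)

/-- The tail integral is continuous and tends to zero, so the intermediate value theorem applies.
Surjectivity makes the chosen value of `gInv` a genuine preimage. -/
lemma gRate_surjOn (hf : IsRateFunction f) :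
    Set.SurjOn (gRate f) (Set.Ici 1) (Set.Ici (gRate f 1)) := by
  intro y hy
  have hcont : ContinuousOn (gRate f) (Set.Ici 1) :=
    hf.integrableOn_Ioi_one.continuousOn_Ici_primitive_Ioi.inv₀ fun t ht => (hf.tail_pos ht).ne'
  have hlim : Tendsto (gRate f) atTop atTop := by
    refine tendsto_inv_nhdsGT_zero.comp (tendsto_nhdsWithin_iff.2 ⟨hf.tail_tendsto, ?_⟩)
    filter_upwards [eventually_ge_atTop 1] with t ht using hf.tail_pos ht
  obtain ⟨T, hT1, hT⟩ := ((eventually_ge_atTop (1 : ℝ)).and (hlim.eventually_ge_atTop y)).exists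
  obtain ⟨t, ht, hty⟩ := intermediate_value_Icc hT1
    (hcont.mono Set.Icc_subset_Ici_self) ⟨hy, hT⟩
  exact ⟨t, ht.1, hty⟩

lemma one_le_gInv (hf : IsRateFunction f) {y : ℝ} (hy : gRate f 1 ≤ y) : 1 ≤ gInv f y :=
  Function.invFunOn_mem (hf.gRate_surjOn hy)

lemma gRate_gInv (hf : IsRateFunction f) {y : ℝ} (hy : gRate f 1 ≤ y) : gRate f (gInv f y) = y :=
  Function.invFunOn_eq (hf.gRate_surjOn hy)

lemma gInv_gRate (hf : IsRateFunction f) {t : ℝ} (ht : 1 ≤ t) : gInv f (gRate f t) = t := by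
  have h := hf.gRate_strictMonoOn.monotoneOn Set.self_mem_Ici ht ht
  exact hf.gRate_strictMonoOn.injOn (hf.one_le_gInv h) ht (hf.gRate_gInv h)

/-- A strictly increasing function whose image contains a neighbourhood of its value cannot jump.
The continuity serves to carry the upper bound on `ρ` from `Ω` to its closure. -/
lemma gInv_continuousAt (hf : IsRateFunction f) {y : ℝ} (hy : gRate f 1 < y) :
    ContinuousAt (gInv f) y := by
  have hmono : StrictMonoOn (gInv f) (Set.Ici (gRate f 1)) := by
    intro s hs t ht hst
    refine (hf.gRate_strictMonoOn.lt_iff_lt (hf.one_le_gInv hs) (hf.one_le_gInv ht)).1 ?_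
    rwa [hf.gRate_gInv hs, hf.gRate_gInv ht]
  refine hmono.continuousAt_of_image_mem_nhds (Ici_mem_nhds hy) ?_
  have h1 : 1 < gInv f y := by
    refine (hf.gRate_strictMonoOn.lt_iff_lt Set.self_mem_Ici (hf.one_le_gInv hy.le)).1 ?_
    rwa [hf.gRate_gInv hy.le]
  refine mem_of_superset (Ici_mem_nhds h1) fun t ht => ⟨gRate f t, ?_, hf.gInv_gRate ht⟩
  exact hf.gRate_strictMonoOn.monotoneOn Set.self_mem_Ici ht ht

lemma _root_.gRate_one_lt_mul_inv {γ δ : ℝ} (hδ : 0 < δ) (h : δ * gRate f 1 < γ) :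
    gRate f 1 < γ * δ⁻¹ := by
  rw [← div_eq_mul_inv, lt_div_iff₀ hδ]; linarith

lemma bumpG_pos (hf : IsRateFunction f) {γ δ : ℝ} (hδ : 0 < δ) (h : δ * gRate f 1 < γ) :
    0 < bumpG f γ δ := by
  rw [bumpG, if_neg hδ.ne']
  exact inv_pos.2 (zero_lt_one.trans_le (hf.one_le_gInv (gRate_one_lt_mul_inv hδ h).le))

lemma bumpG_continuousAt (hf : IsRateFunction f) {γ δ : ℝ} (hδ : 0 < δ)
    (h : δ * gRate f 1 < γ) : ContinuousAt (bumpG f γ) δ := by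
  have hy := gRate_one_lt_mul_inv hδ h
  have h1 : ContinuousAt (fun δ => (gInv f (γ * δ⁻¹))⁻¹) δ := by
    refine ContinuousAt.inv₀ (ContinuousAt.comp (g := gInv f) (hf.gInv_continuousAt hy)
      (continuousAt_const.mul (continuousAt_inv₀ hδ.ne'))) ?_
    exact (zero_lt_one.trans_le (hf.one_le_gInv hy.le)).ne'
  refine h1.congr ?_
  filter_upwards [lt_mem_nhds hδ] with t ht
  rw [bumpG, if_neg ht.ne']

end IsRateFunction

/-! ### Depth along a transverse direction -/

/-- `R` is twice differentiable on `s`, uniformly increasing in the direction `ν`, with first and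
second derivatives bounded by `C` and `M`. -/
structure IsTransverseOn {n : ℕ} (R : CSpace n → ℝ) (s : Set (CSpace n)) (ν : CSpace n)
    (N C M : ℝ) : Prop where
  differentiableAt : ∀ z ∈ s, DifferentiableAt ℝ R z
  differentiableAt_fderiv : ∀ z ∈ s, DifferentiableAt ℝ (fderiv ℝ R) z
  le_fderiv : ∀ z ∈ s, N ≤ fderiv ℝ R z ν
  norm_fderiv_le : ∀ z ∈ s, ‖fderiv ℝ R z‖ ≤ C
  norm_fderiv_fderiv_le : ∀ z ∈ s, ‖fderiv ℝ (fderiv ℝ R) z‖ ≤ M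

/-- Signed distance, in the direction `ν`, from `z` to the zero set of `R` in `s`. -/
noncomputable def depthAlong {n : ℕ} (R : CSpace n → ℝ) (s : Set (CSpace n)) (ν z : CSpace n) : ℝ :=
  Classical.epsilon fun τ : ℝ => z + τ • ν ∈ s ∧ R (z + τ • ν) = 0

namespace IsTransverseOn

variable {n : ℕ} {R : CSpace n → ℝ} {s : Set (CSpace n)} {ν : CSpace n} {N C M : ℝ}

/-- Mean value inequality along `ν`, convexity keeping the segment inside `s`. For `N > 0` it makes
the zero of `R` on each line unique, so the choice in `depthAlong` is no choice, and it stands in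
for the implicit function theorem. -/
lemma mul_sub_le (h : IsTransverseOn R s ν N C M) (hs : Convex ℝ s) {z : CSpace n} {σ τ : ℝ}
    (hσ : z + σ • ν ∈ s) (hτ : z + τ • ν ∈ s) (hστ : σ ≤ τ) :
    N * (τ - σ) ≤ R (z + τ • ν) - R (z + σ • ν) := by
  have hmem : ∀ x ∈ Set.Icc σ τ, z + x • ν ∈ s := by
    intro x hx
    have hl : Convex ℝ ((fun x : ℝ => z + x • ν) ⁻¹' s) := by
      intro x hx y hy a b ha hb hab
      obtain rfl : b = 1 - a := by linarith
      have e : z + (a • x + (1 - a) • y) • ν = a • (z + x • ν) + (1 - a) • (z + y • ν) := by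
        simp only [smul_eq_mul]; module
      exact Set.mem_preimage.2 (e ▸ hs hx hy ha hb hab)
    exact hl.ordConnected.out hσ hτ hx
  have hder : ∀ x ∈ Set.Icc σ τ, HasDerivAt (fun x : ℝ => R (z + x • ν))
      (fderiv ℝ R (z + x • ν) ν) x := by
    intro x hx
    have h1 : HasDerivAt (fun x : ℝ => z + x • ν) ν x := by
      simpa using ((hasDerivAt_id x).smul_const ν).const_add z
    exact (h.differentiableAt _ (hmem x hx)).hasFDerivAt.comp_hasDerivAt x h1
  refine (convex_Icc σ τ).mul_sub_le_image_sub_of_le_deriv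
    (fun x hx => (hder x hx).continuousAt.continuousWithinAt)
    (fun x hx => (hder x (interior_subset hx)).differentiableAt.differentiableWithinAt)
    (fun x hx => ?_) σ (Set.left_mem_Icc.2 hστ) τ (Set.right_mem_Icc.2 hστ) hστ
  rw [(hder x (interior_subset hx)).deriv]
  exact h.le_fderiv _ (hmem x (interior_subset hx))

lemma abs_sub_le (h : IsTransverseOn R s ν N C M) (hs : Convex ℝ s) {x y : CSpace n}
    (hx : x ∈ s) (hy : y ∈ s) : |R x - R y| ≤ C * ‖x - y‖ :=
  hs.norm_image_sub_le_of_norm_fderiv_le h.differentiableAt h.norm_fderiv_le hy hx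

/-- The point `z` can be moved in the direction `ν`, inside `s`, to the zero set of `R`. -/
def Reaches (R : CSpace n → ℝ) (s : Set (CSpace n)) (ν z : CSpace n) : Prop :=
  ∃ τ : ℝ, z + τ • ν ∈ s ∧ R (z + τ • ν) = 0

lemma depthAlong_mem {z : CSpace n} (hz : Reaches R s ν z) : z + depthAlong R s ν z • ν ∈ s :=
  (Classical.epsilon_spec hz).1

lemma apply_depthAlong {z : CSpace n} (hz : Reaches R s ν z) :
    R (z + depthAlong R s ν z • ν) = 0 :=
  (Classical.epsilon_spec hz).2

/-- Monotonicity along `ν` puts every point with `R ≥ 0` at or beyond the zero. Upper bounds for the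
depth are thus obtained by exhibiting points, without solving `R = 0`. -/
lemma depthAlong_le (h : IsTransverseOn R s ν N C M) (hs : Convex ℝ s) (hN : 0 < N) {z : CSpace n}
    (hz : Reaches R s ν z) {q : ℝ} (hq : z + q • ν ∈ s) (hR : 0 ≤ R (z + q • ν)) :
    depthAlong R s ν z ≤ q := by
  by_contra! hlt
  have := h.mul_sub_le hs hq (depthAlong_mem hz) hlt.le
  rw [apply_depthAlong hz] at this
  nlinarith

lemma depthAlong_nonneg (h : IsTransverseOn R s ν N C M) (hs : Convex ℝ s) (hN : 0 < N)
    {z : CSpace n} (hz : Reaches R s ν z) (hzs : z ∈ s) (hR : R z ≤ 0) :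
    0 ≤ depthAlong R s ν z := by
  by_contra! hlt
  have := h.mul_sub_le hs (depthAlong_mem hz) (τ := 0) (by simpa using hzs) hlt.le
  rw [apply_depthAlong hz] at this
  simp at this
  nlinarith

lemma depthAlong_pos (h : IsTransverseOn R s ν N C M) (hs : Convex ℝ s) (hN : 0 < N)
    {z : CSpace n} (hz : Reaches R s ν z) (hzs : z ∈ s) (hR : R z < 0) :
    0 < depthAlong R s ν z := by
  refine lt_of_le_of_ne (h.depthAlong_nonneg hs hN hz hzs hR.le) fun h0 => ?_
  have := apply_depthAlong hz
  rw [← h0] at this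
  simp at this
  linarith

/-- With `neg_le_mul_depthAlong` this makes depth and `-R` comparable: this half serves the lower
bound on `ψ`, the other half the upper bound by `-G^η`. -/
lemma mul_depthAlong_le (h : IsTransverseOn R s ν N C M) (hs : Convex ℝ s) (hN : 0 < N)
    {z : CSpace n} (hz : Reaches R s ν z) (hzs : z ∈ s) (hR : R z ≤ 0) :
    N * depthAlong R s ν z ≤ -R z := by
  have := h.mul_sub_le hs (σ := 0) (by simpa using hzs) (depthAlong_mem hz)
    (h.depthAlong_nonneg hs hN hz hzs hR)
  rw [apply_depthAlong hz] at this
  simpa using this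

lemma neg_le_mul_depthAlong (h : IsTransverseOn R s ν N C M) (hs : Convex ℝ s) (hN : 0 < N)
    {z : CSpace n} (hz : Reaches R s ν z) (hzs : z ∈ s) (hR : R z ≤ 0) :
    -R z ≤ C * ‖ν‖ * depthAlong R s ν z := by
  have h0 := h.depthAlong_nonneg hs hN hz hzs hR
  have := h.abs_sub_le hs (depthAlong_mem hz) hzs
  rw [apply_depthAlong hz, add_sub_cancel_left, norm_smul, Real.norm_of_nonneg h0] at this
  have := le_abs_self (0 - R z)
  linarith

lemma mul_abs_le (h : IsTransverseOn R s ν N C M) (hs : Convex ℝ s)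
    {z : CSpace n} {τ : ℝ} (hτ : z + τ • ν ∈ s) (hzs : z ∈ s) :
    N * |τ| ≤ |R (z + τ • ν) - R z| := by
  have hz0 : z + (0 : ℝ) • ν ∈ s := by simpa using hzs
  rcases le_total 0 τ with h0 | h0
  · have := h.mul_sub_le hs hz0 hτ h0
    simp only [sub_zero, zero_smul, add_zero] at this
    rw [abs_of_nonneg h0]
    exact this.trans (le_abs_self _)
  · have := h.mul_sub_le hs hτ hz0 h0
    simp only [zero_sub, zero_smul, add_zero] at this
    rw [abs_of_nonpos h0, abs_sub_comm]
    exact this.trans (le_abs_self _)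

/-- Moving `z'` by the depth of `z` lands at distance `‖z - z'‖` from a zero of `R`. There `|R|` is
at most `C ‖z - z'‖`, and growth along `ν` turns this into a bound on the remaining displacement. -/
lemma mul_abs_depthAlong_sub_le (h : IsTransverseOn R s ν N C M) (hs : Convex ℝ s)
    {z z' : CSpace n} (hz : Reaches R s ν z) (hz' : Reaches R s ν z')
    (hmem : z' + depthAlong R s ν z • ν ∈ s) :
    N * |depthAlong R s ν z - depthAlong R s ν z'| ≤ C * ‖z - z'‖ := by
  set d := depthAlong R s ν z
  set d' := depthAlong R s ν z'
  have e : z' + d' • ν + (d - d') • ν = z' + d • ν := by module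
  have h1 := h.mul_abs_le hs (z := z' + d' • ν) (τ := d - d') (by rwa [e]) (depthAlong_mem hz')
  rw [e, apply_depthAlong hz', sub_zero] at h1
  have h2 := h.abs_sub_le hs hmem (depthAlong_mem hz)
  rw [apply_depthAlong hz, sub_zero] at h2
  rw [show z' + d • ν - (z + depthAlong R s ν z • ν) = -(z - z') by simp only [d]; module,
    norm_neg] at h2
  linarith

end IsTransverseOn

/-! ### Levi form on real tangent projections, and the exponent inequality -/

/-- Perturbation bound for a quadratic form. -/
lemma quadratic_perturbation {E : Type*} [NormedAddCommGroup E] [NormedSpace ℝ E]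
    {B : E →L[ℝ] E →L[ℝ] ℝ} {M : ℝ} (hB : ‖B‖ ≤ M) (x e : E) :
    B x x - M * (2 * ‖x‖ + ‖e‖) * ‖e‖ ≤ B (x + e) (x + e) := by
  have hb : ∀ x y : E, |B x y| ≤ M * ‖x‖ * ‖y‖ := fun x y =>
    (B.le_opNorm₂ x y).trans (by gcongr)
  have h1 := (abs_le.1 (hb x e)).1
  have h2 := (abs_le.1 (hb e x)).1
  have h3 := (abs_le.1 (hb e e)).1
  simp only [map_add, add_apply]
  nlinarith

/-- If `B` is nonnegative on complex tangent vectors of the kernel of `A`, then on the projections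
of `b` and `ib` to `ker A` along `ν` its sum is bounded below by the normal components. -/
lemma neg_le_levi_projection {n : ℕ} {A : CSpace n →L[ℝ] ℝ}
    {B : CSpace n →L[ℝ] CSpace n →L[ℝ] ℝ} {ν b : CSpace n} {N C M : ℝ} (hN : 0 < N)
    (hAν : N ≤ A ν) (hA : ‖A‖ ≤ C) (hB : ‖B‖ ≤ M)
    (hL : ∀ X : CSpace n, A X = 0 → A (Complex.I • X) = 0 →
      0 ≤ B X X + B (Complex.I • X) (Complex.I • X)) :
    -(24 * M * ‖ν‖ * (1 + 4 * C * ‖ν‖ / N) * ‖b‖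
        * (|A b / A ν| + |A (Complex.I • b) / A ν|)) ≤
      B (b - (A b / A ν) • ν) (b - (A b / A ν) • ν)
        + B (Complex.I • b - (A (Complex.I • b) / A ν) • ν)
          (Complex.I • b - (A (Complex.I • b) / A ν) • ν) := by
  have hα : 0 < A ν := hN.trans_le hAν
  have hM : 0 ≤ M := (norm_nonneg B).trans hB
  have hC : 0 ≤ C := (norm_nonneg A).trans hA
  set l₁ := A b / A ν with hl₁
  set l₂ := A (Complex.I • b) / A ν with hl₂
  set κ := A (Complex.I • ν) / A ν with hκ
  have e1 : A b = l₁ * A ν := by rw [hl₁]; field_simp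
  have e2 : A (Complex.I • b) = l₂ * A ν := by rw [hl₂]; field_simp
  have e3 : A (Complex.I • ν) = κ * A ν := by rw [hκ]; field_simp
  have hκ2 : 0 < 1 + κ ^ 2 := by positivity
  -- The projections of `b` and `ib` along `ν` are only real tangent. These coefficients solve the
  -- 2×2 system making `b + μ₁ν + μ₂iν` complex tangent; the determinant `-(1 + κ²)` never vanishes.
  set μ₁ := -(l₁ + κ * l₂) / (1 + κ ^ 2) with hμ₁
  set μ₂ := (l₂ - κ * l₁) / (1 + κ ^ 2) with hμ₂
  have m1 : l₁ + μ₁ + κ * μ₂ = 0 := by rw [hμ₁, hμ₂]; field_simp; ring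
  have m2 : l₂ + κ * μ₁ - μ₂ = 0 := by rw [hμ₁, hμ₂]; field_simp; ring
  set Λ := |l₁| + |l₂| with hΛ
  have hΛ0 : 0 ≤ Λ := by positivity
  have hκ1 : |κ| ≤ 1 + κ ^ 2 := by
    rw [← sq_abs κ]; nlinarith [sq_nonneg (|κ| - 1), abs_nonneg κ]
  have b1 : |μ₁| ≤ Λ := by
    rw [hμ₁, abs_div, abs_of_pos hκ2, div_le_iff₀ hκ2, abs_neg]
    refine (abs_add_le _ _).trans ?_
    rw [abs_mul, hΛ]
    nlinarith [abs_nonneg l₁, abs_nonneg l₂, sq_nonneg κ,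
      mul_le_mul_of_nonneg_right hκ1 (abs_nonneg l₂)]
  have b2 : |μ₂| ≤ Λ := by
    rw [hμ₂, abs_div, abs_of_pos hκ2, div_le_iff₀ hκ2]
    refine (abs_sub _ _).trans ?_
    rw [abs_mul, hΛ]
    nlinarith [abs_nonneg l₁, abs_nonneg l₂, sq_nonneg κ,
      mul_le_mul_of_nonneg_right hκ1 (abs_nonneg l₁)]
  have nI : ∀ x : CSpace n, ‖Complex.I • x‖ = ‖x‖ := fun x => by simp [norm_smul]
  have II : ∀ x : CSpace n, Complex.I • Complex.I • x = -x := fun x => by simp [smul_smul]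
  have Ir : ∀ (r : ℝ) (x : CSpace n), Complex.I • r • x = r • Complex.I • x :=
    fun r x => smul_comm _ _ _
  set X : CSpace n := b + μ₁ • ν + μ₂ • Complex.I • ν with hX
  have hIX : Complex.I • X = Complex.I • b + μ₁ • Complex.I • ν - μ₂ • ν := by
    rw [hX, smul_add, smul_add, Ir, Ir, II]; module
  have hlevi := hL X (by
      rw [hX]; simp only [map_add, map_smul, smul_eq_mul, e1, e3]
      linear_combination A ν * m1) (by
      rw [hIX]; simp only [map_add, map_sub, map_smul, smul_eq_mul, e2, e3]
      linear_combination A ν * m2)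
  set P := 1 + 4 * C * ‖ν‖ / N with hP
  have hΛb : Λ ≤ 2 * C * ‖b‖ / N := by
    have hb1 : |l₁| ≤ C * ‖b‖ / N := by
      rw [hl₁, abs_div, abs_of_pos hα]
      exact div_le_div₀ (by positivity) ((A.le_opNorm b).trans (by gcongr)) hN hAν
    have hb2 : |l₂| ≤ C * ‖b‖ / N := by
      rw [hl₂, abs_div, abs_of_pos hα]
      refine div_le_div₀ (by positivity) ((A.le_opNorm _).trans ?_) hN hAν
      rw [nI]; gcongr
    calc Λ ≤ C * ‖b‖ / N + C * ‖b‖ / N := add_le_add hb1 hb2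
      _ = _ := by ring
  have hΛP : ‖b‖ + 2 * Λ * ‖ν‖ ≤ P * ‖b‖ := by
    calc ‖b‖ + 2 * Λ * ‖ν‖ ≤ ‖b‖ + 2 * (2 * C * ‖b‖ / N) * ‖ν‖ := by gcongr
      _ = P * ‖b‖ := by rw [hP]; ring
  -- Each projection differs from `X` or `iX` by at most `3Λ‖ν‖`, so each of the two directions
  -- costs `4 · 3 = 12`; hence the `24` in the statement.
  have bound : ∀ (x e : CSpace n), ‖x‖ ≤ ‖b‖ + 2 * Λ * ‖ν‖ → ‖e‖ ≤ 3 * Λ * ‖ν‖ →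
      B x x - 12 * M * ‖ν‖ * P * ‖b‖ * Λ ≤ B (x + e) (x + e) := by
    intro x e hx he
    refine le_trans ?_ (quadratic_perturbation hB x e)
    have h1 : 2 * ‖x‖ + ‖e‖ ≤ 4 * (P * ‖b‖) := by
      have : 0 ≤ Λ * ‖ν‖ := by positivity
      nlinarith [norm_nonneg b]
    have : M * (2 * ‖x‖ + ‖e‖) * ‖e‖ ≤ M * (4 * (P * ‖b‖)) * (3 * Λ * ‖ν‖) := by gcongr
    linarith
  have nX : ‖X‖ ≤ ‖b‖ + 2 * Λ * ‖ν‖ := by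
    calc ‖X‖ ≤ ‖b‖ + ‖μ₁ • ν‖ + ‖μ₂ • Complex.I • ν‖ := norm_add₃_le
      _ = ‖b‖ + |μ₁| * ‖ν‖ + |μ₂| * ‖ν‖ := by rw [norm_smul, norm_smul, nI]; rfl
      _ ≤ ‖b‖ + Λ * ‖ν‖ + Λ * ‖ν‖ := by gcongr
      _ = _ := by ring
  have c1 : |l₁| ≤ Λ := by rw [hΛ]; linarith [abs_nonneg l₂]
  have c2 : |l₂| ≤ Λ := by rw [hΛ]; linarith [abs_nonneg l₁]
  have h1 := bound X ((-l₁ - μ₁) • ν + (-μ₂) • Complex.I • ν) nX (by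
    calc _ ≤ ‖(-l₁ - μ₁) • ν‖ + ‖(-μ₂) • Complex.I • ν‖ := norm_add_le _ _
      _ = |-l₁ - μ₁| * ‖ν‖ + |μ₂| * ‖ν‖ := by
        rw [norm_smul, norm_smul, nI, Real.norm_eq_abs, Real.norm_eq_abs, abs_neg μ₂]
      _ ≤ (|l₁| + |μ₁|) * ‖ν‖ + |μ₂| * ‖ν‖ := by
        gcongr; exact (abs_sub _ _).trans (by rw [abs_neg])
      _ ≤ (Λ + Λ) * ‖ν‖ + Λ * ‖ν‖ := by gcongr
      _ = _ := by ring)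
  have h2 := bound (Complex.I • X) ((-l₂ + μ₂) • ν + (-μ₁) • Complex.I • ν)
    ((nI X).trans_le nX) (by
    calc _ ≤ ‖(-l₂ + μ₂) • ν‖ + ‖(-μ₁) • Complex.I • ν‖ := norm_add_le _ _
      _ = |-l₂ + μ₂| * ‖ν‖ + |μ₁| * ‖ν‖ := by
        rw [norm_smul, norm_smul, nI, Real.norm_eq_abs, Real.norm_eq_abs, abs_neg μ₁]
      _ ≤ (|l₂| + |μ₂|) * ‖ν‖ + |μ₁| * ‖ν‖ := by
        gcongr; exact (abs_add_le _ _).trans (by rw [abs_neg])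
      _ ≤ (Λ + Λ) * ‖ν‖ + Λ * ‖ν‖ := by gcongr
      _ = _ := by ring)
  rw [show X + ((-l₁ - μ₁) • ν + (-μ₂) • Complex.I • ν) = b - l₁ • ν by rw [hX]; module] at h1
  rw [show Complex.I • X + ((-l₂ + μ₂) • ν + (-μ₁) • Complex.I • ν)
    = Complex.I • b - l₂ • ν by rw [hIX]; module] at h2
  linarith

/-- The Diederich–Fornæss exponent inequality, with `x₁, x₂` the logarithmic derivatives of the
depth and `σ₁, σ₂` those of the weight in two orthogonal directions. -/
lemma weighted_log_laplacian_neg {η K L d β ε₀ l₁ l₂ Q₁ Q₂ σ₁ σ₂ : ℝ} (hη₀ : 0 < η) (hη₁ : η < 1)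
    (hL : L = 1 + K ^ 2 / (1 - η)) (hε : 16 * L ^ 2 * ε₀ ^ 2 ≤ 1 - η)
    (hd : 0 < d) (hβ : 0 < β) (hσ₁ : |σ₁| ≤ 2 * ε₀ * β) (hσ₂ : |σ₂| ≤ 2 * ε₀ * β)
    (hQ : Q₁ + Q₂ ≤ K * β * (|l₁| + |l₂|) + d * β ^ 2 / 2) :
    (2 * Q₁ / d - (l₁ / d) ^ 2 - 2 * L * β ^ 2 + η * (l₁ / d - L * σ₁) ^ 2)
      + (2 * Q₂ / d - (l₂ / d) ^ 2 - 2 * L * β ^ 2 + η * (l₂ / d - L * σ₂) ^ 2) < 0 := by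
  have hκ : 0 < 1 - η := by linarith
  -- The gap `1 - η` between `x²` and `ηx²` is spent in halves: one on the cross term with the
  -- weight gradient, one on the linear Levi error.
  have hmain : ∀ l σ : ℝ, |σ| ≤ 2 * ε₀ * β →
      2 * K * β * |l / d| - (l / d) ^ 2 + η * (l / d - L * σ) ^ 2
        ≤ 2 * K ^ 2 * β ^ 2 / (1 - η) + β ^ 2 / 2 := by
    intro l σ hσ
    generalize l / d = x
    have hσ2 : σ ^ 2 ≤ 4 * ε₀ ^ 2 * β ^ 2 := by
      have := pow_le_pow_left₀ (abs_nonneg σ) hσ 2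
      rw [sq_abs] at this; linarith
    have h1 : η * (x - L * σ) ^ 2 ≤ (1 + η) / 2 * x ^ 2 + 2 / (1 - η) * (L * σ) ^ 2 := by
      rw [← sub_nonneg]
      have : (1 + η) / 2 * x ^ 2 + 2 / (1 - η) * (L * σ) ^ 2 - η * (x - L * σ) ^ 2
          = ((1 - η) * x + 2 * η * (L * σ)) ^ 2 / (2 * (1 - η)) + (2 + η) * (L * σ) ^ 2 := by
        field_simp; ring
      rw [this]; positivity
    have h2 : 2 * K * β * |x| ≤ (1 - η) / 2 * x ^ 2 + 2 * K ^ 2 * β ^ 2 / (1 - η) := by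
      rw [← sq_abs x, ← sub_nonneg]
      have : (1 - η) / 2 * |x| ^ 2 + 2 * K ^ 2 * β ^ 2 / (1 - η) - 2 * K * β * |x|
          = ((1 - η) * |x| - 2 * K * β) ^ 2 / (2 * (1 - η)) := by field_simp; ring
      rw [this]; positivity
    have h3 : 2 / (1 - η) * (L * σ) ^ 2 ≤ β ^ 2 / 2 := by
      rw [div_mul_eq_mul_div, div_le_iff₀ hκ]
      nlinarith [mul_le_mul_of_nonneg_left hσ2 (sq_nonneg L),
        mul_le_mul_of_nonneg_right hε (sq_nonneg β)]
    linarith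
  have h1 := hmain l₁ σ₁ hσ₁
  have h2 := hmain l₂ σ₂ hσ₂
  have hQ' : 2 * Q₁ / d + 2 * Q₂ / d ≤ 2 * K * β * |l₁ / d| + 2 * K * β * |l₂ / d| + β ^ 2 := by
    rw [abs_div, abs_div, abs_of_pos hd]
    have : (2 * K * β * (|l₁| / d) + 2 * K * β * (|l₂| / d) + β ^ 2) =
      2 * (K * β * (|l₁| + |l₂|) + d * β ^ 2 / 2) / d := by field_simp
    rw [this, ← add_div]
    gcongr; linarith
  -- The second summand of `L` cancels the Levi error exactly; its `1` yields `4β²` against a total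
  -- remainder of `2β²`.
  have h4 : 4 * L * β ^ 2 = 4 * β ^ 2 + 2 * (2 * K ^ 2 * β ^ 2 / (1 - η)) := by rw [hL]; ring
  nlinarith [sq_pos_of_pos hβ]

/-- First and second derivative of `t ↦ -exp (η (log q - L s))` for quadratic polynomials. -/
lemma hasDerivAt_neg_exp_log {η L d l Q s₀ σ τ : ℝ} (hd : 0 < d) :
    ∃ v' : ℝ → ℝ, (∀ᶠ t in 𝓝 0, HasDerivAt (fun t : ℝ => -Real.exp (η * (Real.log
        (d + l * t + Q * t ^ 2) - L * (s₀ + σ * t + τ * t ^ 2)))) (v' t) t) ∧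
      HasDerivAt v' (-(η * Real.exp (η * (Real.log d - L * s₀))) *
        (2 * Q / d - (l / d) ^ 2 - 2 * L * τ + η * (l / d - L * σ) ^ 2)) 0 := by
  have hq : ∀ t : ℝ, HasDerivAt (fun t : ℝ => d + l * t + Q * t ^ 2) (l + 2 * Q * t) t := by
    intro t
    have := (((hasDerivAt_id t).const_mul l).const_add d).add ((hasDerivAt_pow 2 t).const_mul Q)
    refine this.congr_deriv ?_
    simp; ring
  have hs : ∀ t : ℝ, HasDerivAt (fun t : ℝ => s₀ + σ * t + τ * t ^ 2) (σ + 2 * τ * t) t := by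
    intro t
    have := (((hasDerivAt_id t).const_mul σ).const_add s₀).add ((hasDerivAt_pow 2 t).const_mul τ)
    refine this.congr_deriv ?_
    simp; ring
  have hpos : ∀ᶠ t : ℝ in 𝓝 0, 0 < d + l * t + Q * t ^ 2 := by
    have : ContinuousAt (fun t : ℝ => d + l * t + Q * t ^ 2) 0 := (hq 0).continuousAt
    exact this.eventually (lt_mem_nhds (by simpa using hd))
  have hexp : ∀ t : ℝ, 0 < d + l * t + Q * t ^ 2 → HasDerivAt (fun t : ℝ => -Real.exp (η * (Real.log
        (d + l * t + Q * t ^ 2) - L * (s₀ + σ * t + τ * t ^ 2))))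
      (-(Real.exp (η * (Real.log (d + l * t + Q * t ^ 2) - L * (s₀ + σ * t + τ * t ^ 2))) *
        (η * ((l + 2 * Q * t) / (d + l * t + Q * t ^ 2) - L * (σ + 2 * τ * t))))) t :=
    fun t ht => ((((hq t).log ht.ne').sub ((hs t).const_mul L)).const_mul η).exp.neg
  refine ⟨_, hpos.mono hexp, ?_⟩
  have hl : HasDerivAt (fun t : ℝ => l + 2 * Q * t) (2 * Q) 0 := by
    simpa using ((hasDerivAt_id (0 : ℝ)).const_mul (2 * Q)).const_add l
  have hl' : HasDerivAt (fun t : ℝ => σ + 2 * τ * t) (2 * τ) 0 := by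
    simpa using ((hasDerivAt_id (0 : ℝ)).const_mul (2 * τ)).const_add σ
  have h1 := hexp 0 (by simpa using hd)
  -- With `φ` the exponent, the first derivative is `(-e^φ) · φ'`, and `h1` is reused for its first
  -- factor, giving `-e^φ (φ'² + φ'')`.
  have h2 := h1.mul ((((hl.div (hq 0) (by simpa using hd.ne')).sub (hl'.const_mul L)).const_mul η))
  refine (h2.congr_deriv ?_).congr_of_eventuallyEq ?_
  · simp; field_simp; ring
  · filter_upwards with t
    simp

/-! ### Second-order support of the depth, and plurisubharmonicity -/

namespace IsTransverseOn

variable {n : ℕ} {R : CSpace n → ℝ} {s : Set (CSpace n)} {ν : CSpace n} {N C M : ℝ}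

/-- Along every real line, the depth has quadratic upper support functions, whose coefficients are
given by the first two derivatives of `R` at the boundary point. -/
lemma eventually_depthAlong_le_quadratic (h : IsTransverseOn R s ν N C M) (hso : IsOpen s)
    (hs : Convex ℝ s) (hN : 0 < N) {a : CSpace n} (ha : Reaches R s ν a) {A : CSpace n →L[ℝ] ℝ}
    {B : CSpace n →L[ℝ] CSpace n →L[ℝ] ℝ} (hA : A = fderiv ℝ R (a + depthAlong R s ν a • ν))
    (hB : B = fderiv ℝ (fderiv ℝ R) (a + depthAlong R s ν a • ν)) (b : CSpace n) {ε : ℝ}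
    (hε : 0 < ε) :
    ∀ᶠ t : ℝ in 𝓝 0, Reaches R s ν (a + t • b) → depthAlong R s ν (a + t • b) ≤
      depthAlong R s ν a + -(A b / A ν) * t
        + (-(B (b - (A b / A ν) • ν) (b - (A b / A ν) • ν)) / (2 * A ν) + ε) * t ^ 2 := by
  set d := depthAlong R s ν a with hd
  set p := a + d • ν with hp
  have hps : p ∈ s := depthAlong_mem ha
  have hα : 0 < A ν := hN.trans_le (hA ▸ h.le_fderiv p hps)
  set x := b - (A b / A ν) • ν with hx
  set Q := -(B x x) / (2 * A ν) + ε with hQ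
  -- A parabola through the boundary point `p` with velocity `x` in `ker A`. `Q` is chosen so that
  -- `R ∘ γ` has second derivative `2εA(ν) > 0`, hence a local minimum with value `0`; the slack `ε`
  -- is what makes twice differentiability enough.
  set γ : ℝ → CSpace n := fun t => p + t • x + (Q * t ^ 2) • ν with hγ
  have hγ0 : γ 0 = p := by simp [hγ]
  have hγd : ∀ t, HasDerivAt γ (x + (2 * Q * t) • ν) t := by
    intro t
    have h1 : HasDerivAt (fun t : ℝ => p + t • x) x t := by
      simpa using ((hasDerivAt_id t).smul_const x).const_add p
    have h2 : HasDerivAt (fun t : ℝ => (Q * t ^ 2) • ν) ((2 * Q * t) • ν) t := by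
      have := ((hasDerivAt_pow 2 t).const_mul Q).smul_const ν
      refine this.congr_deriv ?_
      congr 1
      simp; ring
    exact h1.add h2
  have hγs : ∀ᶠ t in 𝓝 0, γ t ∈ s :=
    (hγd 0).continuousAt.eventually (hso.mem_nhds (by rwa [hγ0]))
  have hF : ∀ᶠ t in 𝓝 0, HasDerivAt (fun t => R (γ t))
      (fderiv ℝ R (γ t) (x + (2 * Q * t) • ν)) t := by
    filter_upwards [hγs] with t ht
    exact (h.differentiableAt _ ht).hasFDerivAt.comp_hasDerivAt t (hγd t)
  have hF2 : HasDerivAt (fun t => fderiv ℝ R (γ t) (x + (2 * Q * t) • ν)) (2 * ε * A ν) 0 := by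
    have h1 : HasDerivAt (fun t => fderiv ℝ R (γ t)) (B x) 0 := by
      have := (h.differentiableAt_fderiv _ hps).hasFDerivAt
      rw [← hB, ← hγ0] at this
      exact (this.comp_hasDerivAt 0 (hγd 0)).congr_deriv (by simp)
    have h2 : HasDerivAt (fun t : ℝ => x + (2 * Q * t) • ν) ((2 * Q) • ν) 0 := by
      simpa using (((hasDerivAt_id (0 : ℝ)).const_mul (2 * Q)).smul_const ν).const_add x
    refine (h1.clm_apply h2).congr_deriv ?_
    rw [hγ0, ← hA]
    simp only [mul_zero, zero_smul, add_zero, map_smul, smul_eq_mul]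
    rw [hQ]; field_simp; ring
  have hAx : A x = 0 := by rw [hx]; simp; field_simp; simp
  have hmin : IsLocalMin (fun t => R (γ t)) 0 := by
    have hdF : deriv (fun t => R (γ t)) =ᶠ[𝓝 0] fun t => fderiv ℝ R (γ t) (x + (2 * Q * t) • ν) :=
      hF.mono fun t ht => ht.deriv
    refine isLocalMin_of_deriv_deriv_pos ?_ ?_ hF.self_of_nhds.continuousAt
    · rw [hdF.deriv_eq, hF2.deriv]; positivity
    · rw [hdF.self_of_nhds]; simpa [hγ0, ← hA] using hAx
  filter_upwards [hmin, hγs] with t ht hts hr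
  have e : a + t • b + (d + -(A b / A ν) * t + Q * t ^ 2) • ν = γ t := by
    simp only [hγ, hp, hx]; module
  refine h.depthAlong_le hs hN hr (e ▸ hts) ?_
  rw [e]
  refine le_trans ?_ ht
  simp only [hγ0]
  exact (apply_depthAlong ha).ge

end IsTransverseOn

lemma mul_exp_rpow {q x η : ℝ} (hq : 0 < q) :
    (q * Real.exp (-x)) ^ η = Real.exp (η * (Real.log q - x)) := by
  rw [Real.rpow_def_of_pos (by positivity), Real.log_mul hq.ne' (Real.exp_pos _).ne', Real.log_exp]
  congr 1; ring

/-- The Diederich–Fornæss function with exponent `η` built from the depth. -/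
noncomputable def weightedDepth {n : ℕ} (R : CSpace n → ℝ) (s : Set (CSpace n)) (ν z₀ : CSpace n)
    (L : ℝ) (z : CSpace n) : ℝ :=
  depthAlong R s ν z * Real.exp (-(L * ‖z - z₀‖ ^ 2))

open IsTransverseOn in
/-- **Diederich–Fornæss**: a power of the weighted depth is plurisubharmonic. -/
theorem isPlurisubharmonicOn_weightedDepth {n : ℕ} {R : CSpace n → ℝ} {s D : Set (CSpace n)}
    {ν z₀ : CSpace n} {N C M η L ε₀ K : ℝ}
    (h : IsTransverseOn R s ν N C M) (hso : IsOpen s) (hs : Convex ℝ s) (hN : 0 < N)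
    (hlevi : LeviPseudoconvexZeroSet R s) (hη₀ : 0 < η) (hη₁ : η < 1) (hK : 0 < K)
    (hL : L = 1 + (12 * M * ‖ν‖ * (1 + 4 * C * ‖ν‖ / N) / N) ^ 2 / (1 - η))
    (hε : 16 * L ^ 2 * ε₀ ^ 2 ≤ 1 - η)
    (hDs : D ⊆ s) (hreach : ∀ z ∈ D, Reaches R s ν z) (hneg : ∀ z ∈ D, R z < 0)
    (hDε : ∀ z ∈ D, ‖z - z₀‖ ≤ ε₀) (hcont : ContinuousOn (depthAlong R s ν) D) :
    IsPlurisubharmonicOn (fun z => -(K * weightedDepth R s ν z₀ L z ^ η)) D := by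
  have hψ : ContinuousOn (fun z => -(K * weightedDepth R s ν z₀ L z ^ η)) D := by
    refine (continuousOn_const.mul (ContinuousOn.rpow_const (hcont.mul ?_)
      fun _ _ => Or.inr hη₀.le)).neg
    fun_prop
  refine ⟨hψ.upperSemicontinuousOn, fun a b hab => ?_⟩
  have hu : ContinuousOn (fun ζ : ℂ => -(K * weightedDepth R s ν z₀ L (a + ζ • b) ^ η))
      (closedBall 0 1) := by
    refine hψ.comp (f := fun ζ : ℂ => a + ζ • b) (by fun_prop) fun ζ hζ => hab ζ ?_
    simpa using hζ
  refine ⟨(hu.mono sphere_subset_closedBall).circleIntegrable zero_le_one, ?_⟩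
  rcases eq_or_ne b 0 with rfl | hb
  · simp [Real.circleAverage_const]
  -- In the disc, moving `ζ` in the directions `1` and `i` moves the point along `b` and `ib`; the
  -- claim is needed only on these two real lines.
  suffices H : ∀ a' ∈ D, (∀ᶠ t : ℝ in 𝓝 0, a' + t • b ∈ D) →
      (∀ᶠ t : ℝ in 𝓝 0, a' + t • Complex.I • b ∈ D) → ∃ (v v' : ℝ → ℝ) (c : ℝ), 0 < c ∧
      (∀ᶠ t in 𝓝 0, HasDerivAt v (v' t) t) ∧ HasDerivAt v' c 0 ∧
      v 0 = 2 * -(K * weightedDepth R s ν z₀ L a' ^ η) ∧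
      ∀ᶠ t : ℝ in 𝓝 0, v t ≤ -(K * weightedDepth R s ν z₀ L (a' + t • b) ^ η)
        + -(K * weightedDepth R s ν z₀ L (a' + t • Complex.I • b) ^ η) by
    have := le_circleAverage_of_lower_support hu fun ζ hζ => ?_
    · simpa using this
    have hev : ∀ e : ℂ, ∀ᶠ t : ℝ in 𝓝 0, a + (ζ + t * e) • b ∈ D := by
      intro e
      have hct : ContinuousAt (fun t : ℝ => ζ + t * e) 0 := by fun_prop
      refine (hct.eventually (isOpen_ball.mem_nhds
        (show ζ + ((0 : ℝ) : ℂ) * e ∈ ball 0 1 by simpa using hζ))).mono fun t ht => hab _ ?_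
      simpa using (ball_subset_closedBall ht)
    have e1 : ∀ (e : ℂ) (t : ℝ), a + (ζ + t * e) • b = a + ζ • b + t • e • b := by
      intro e t
      rw [add_smul, mul_smul, add_assoc]; rfl
    have e2 : ∀ t : ℝ, a + (ζ + t) • b = a + ζ • b + t • b := by
      intro t; simpa using e1 1 t
    obtain ⟨v, v', c, hc, h1, h2, h3, h4⟩ := H (a + ζ • b)
      (hab ζ (by simpa using ball_subset_closedBall hζ))
      (by simpa [e2] using hev 1) (by simpa [e1] using hev Complex.I)
    exact ⟨v, v', c, hc, h1, h2, h3, by simpa only [e1, e2] using h4⟩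
  intro a ha hev₁ hev₂
  have har := hreach a ha
  set d := depthAlong R s ν a with hd
  have hd0 : 0 < d := h.depthAlong_pos hs hN har (hDs ha) (hneg a ha)
  have hβ : 0 < ‖b‖ := norm_pos_iff.2 hb
  set p := a + d • ν with hp
  have hps : p ∈ s := depthAlong_mem har
  obtain ⟨A, hA⟩ : ∃ A, A = fderiv ℝ R p := ⟨_, rfl⟩
  obtain ⟨B, hB⟩ : ∃ B, B = fderiv ℝ (fderiv ℝ R) p := ⟨_, rfl⟩
  have hAν : N ≤ A ν := hA ▸ h.le_fderiv p hps
  have hα : 0 < A ν := hN.trans_le hAν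
  -- The slack used in each direction; twice it is the `dβ²/2` tolerated by
  -- `weighted_log_laplacian_neg`.
  have hεpos : 0 < d * ‖b‖ ^ 2 / 4 := by positivity
  have hI : ‖Complex.I • b‖ = ‖b‖ := by simp [norm_smul]
  have hlb := neg_le_levi_projection (A := A) (B := B) (b := b) hN hAν
    (hA ▸ h.norm_fderiv_le p hps) (hB ▸ h.norm_fderiv_fderiv_le p hps) (by
      intro X h1 h2
      have := hlevi p hps (apply_depthAlong har) X ⟨by rw [← hA]; exact h1, by rw [← hA]; exact h2⟩
      rw [leviForm, ← hB] at this
      linarith)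
  have sup₁ := h.eventually_depthAlong_le_quadratic hso hs hN har hA hB b hεpos
  have sup₂ := h.eventually_depthAlong_le_quadratic hso hs hN har hA hB (Complex.I • b) hεpos
  set B₁ := B (b - (A b / A ν) • ν) (b - (A b / A ν) • ν)
  set B₂ := B (Complex.I • b - (A (Complex.I • b) / A ν) • ν)
          (Complex.I • b - (A (Complex.I • b) / A ν) • ν)
  set Q₁ := -B₁ / (2 * A ν) + d * ‖b‖ ^ 2 / 4 with hQ₁
  set Q₂ := -B₂ / (2 * A ν) + d * ‖b‖ ^ 2 / 4 with hQ₂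
  set l₁ := -(A b / A ν) with hl₁
  set l₂ := -(A (Complex.I • b) / A ν) with hl₂
  set K₁ := 12 * M * ‖ν‖ * (1 + 4 * C * ‖ν‖ / N) / N with hK₁
  have hM : 0 ≤ M := (norm_nonneg (fderiv ℝ (fderiv ℝ R) p)).trans (h.norm_fderiv_fderiv_le p hps)
  have hC : 0 ≤ C := (norm_nonneg _).trans (h.norm_fderiv_le p hps)
  have hQ : Q₁ + Q₂ ≤ K₁ * ‖b‖ * (|l₁| + |l₂|) + d * ‖b‖ ^ 2 / 2 := by
    have e : Q₁ + Q₂ = -(B₁ + B₂) / (2 * A ν) + d * ‖b‖ ^ 2 / 2 := by rw [hQ₁, hQ₂]; ring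
    rw [e]
    gcongr
    rw [hl₁, hl₂, abs_neg, abs_neg]
    calc -(B₁ + B₂) / (2 * A ν) ≤ (24 * M * ‖ν‖ * (1 + 4 * C * ‖ν‖ / N) * ‖b‖
        * (|A b / A ν| + |A (Complex.I • b) / A ν|)) / (2 * N) := by
          refine div_le_div₀ (by positivity) (by linarith) (by positivity) (by linarith)
      _ = _ := by rw [hK₁]; field_simp; ring
  -- The weight exponent is exactly quadratic along lines, so only the depth has to be replaced by a
  -- support function.
  have hsq : ∀ (e : CSpace n) (t : ℝ), ‖a + t • e - z₀‖ ^ 2 = ‖a - z₀‖ ^ 2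
      + (2 * (inner ℂ (a - z₀) e).re) * t + ‖e‖ ^ 2 * t ^ 2 := by
    intro e t
    rw [show a + t • e - z₀ = (a - z₀) + (t : ℂ) • e by
      rw [Complex.coe_smul]; module, norm_add_sq (𝕜 := ℂ), inner_smul_right, norm_smul]
    generalize inner ℂ (a - z₀) e = x
    simp [mul_pow]; ring
  have hσ : ∀ e : CSpace n, ‖e‖ = ‖b‖ → |2 * (inner ℂ (a - z₀) e).re| ≤ 2 * ε₀ * ‖b‖ := by
    intro e he
    rw [abs_mul, abs_two, mul_assoc]
    refine mul_le_mul_of_nonneg_left ?_ zero_le_two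
    calc _ ≤ ‖a - z₀‖ * ‖e‖ := (Complex.abs_re_le_norm _).trans (norm_inner_le_norm _ _)
      _ ≤ _ := by rw [he]; gcongr; exact hDε a ha
  have hlap := weighted_log_laplacian_neg hη₀ hη₁ hL hε hd0 hβ (hσ b rfl) (hσ _ hI) hQ
  obtain ⟨v₁, hv₁, hv₁'⟩ := hasDerivAt_neg_exp_log (η := η) (L := L) (l := l₁) (Q := Q₁)
    (s₀ := ‖a - z₀‖ ^ 2) (σ := 2 * (inner ℂ (a - z₀) b).re) (τ := ‖b‖ ^ 2) hd0
  obtain ⟨v₂, hv₂, hv₂'⟩ := hasDerivAt_neg_exp_log (η := η) (L := L) (l := l₂) (Q := Q₂)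
    (s₀ := ‖a - z₀‖ ^ 2) (σ := 2 * (inner ℂ (a - z₀) (Complex.I • b)).re) (τ := ‖b‖ ^ 2) hd0
  have hv' := (hv₁'.add hv₂').const_mul K
  have hv := (hv₁.and hv₂).mono fun t ht => (ht.1.add ht.2).const_mul K
  refine ⟨_, _, _, ?_, hv, hv', ?_, ?_⟩
  rotate_left
  · simp only [Pi.add_apply, weightedDepth, mul_exp_rpow hd0, ← hd]
    simp; ring
  · have hle : ∀ (e : CSpace n) (l Q : ℝ), ‖e‖ = ‖b‖ → (∀ᶠ t : ℝ in 𝓝 0, a + t • e ∈ D) →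
        (∀ᶠ t : ℝ in 𝓝 0, Reaches R s ν (a + t • e) →
          depthAlong R s ν (a + t • e) ≤ d + l * t + Q * t ^ 2) →
        ∀ᶠ t : ℝ in 𝓝 0, weightedDepth R s ν z₀ L (a + t • e) ^ η ≤
          Real.exp (η * (Real.log (d + l * t + Q * t ^ 2) - L * (‖a - z₀‖ ^ 2
            + (2 * (inner ℂ (a - z₀) e).re) * t + ‖b‖ ^ 2 * t ^ 2))) := by
      intro e l Q he hmem hsup
      filter_upwards [hmem, hsup] with t h1 h2
      have h3 := h.depthAlong_pos hs hN (hreach _ h1) (hDs h1) (hneg _ h1)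
      have h4 := h2 (hreach _ h1)
      rw [← mul_exp_rpow (h3.trans_le h4), weightedDepth, hsq, he]
      gcongr
    filter_upwards [hle b l₁ Q₁ rfl hev₁ sup₁, hle _ l₂ Q₂ hI hev₂ sup₂] with t h1 h2
    have h3 := mul_le_mul_of_nonneg_left (add_le_add h1 h2) hK.le
    simp only [Pi.add_apply]
    linarith
  · have : 0 < η * Real.exp (η * (Real.log d - L * ‖a - z₀‖ ^ 2)) := by positivity
    refine mul_pos hK ?_
    rw [← mul_add]
    exact mul_pos_of_neg_of_neg (neg_neg_of_pos this) hlap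

/-! ### Uniform transversality of the family -/

/-- A `C²` family of functions whose central member has nonzero derivative at `z₀` is uniformly
transverse to a fixed direction near `z₀`. -/
lemma exists_isTransverseOn {n : ℕ} {U F : Set (CSpace n)} {z₀ : CSpace n}
    {ρ : CSpace n → CSpace n → ℝ} (hU : IsOpen U) (hz₀ : z₀ ∈ U ∩ F)
    (hρ : ContDiffOn ℝ 2 (fun p : CSpace n × CSpace n => ρ p.1 p.2) (U ×ˢ (U ∩ F)))
    (hne : fderiv ℝ (fun z => ρ z z₀) z₀ ≠ 0) :
    ∃ (r N C M : ℝ) (ν : CSpace n), 0 < r ∧ 0 < N ∧ 0 ≤ C ∧ ball z₀ r ⊆ U ∧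
      ∀ w ∈ ball z₀ r ∩ F, IsTransverseOn (fun z => ρ z w) (ball z₀ r) ν N C M := by
  set S := U ×ˢ (U ∩ F) with hS
  have hx : (z₀, z₀) ∈ S := ⟨hz₀.1, hz₀⟩
  have h2 : ContDiffWithinAt ℝ (1 + 1) (fun p : CSpace n × CSpace n => ρ p.1 p.2) S (z₀, z₀) := by
    simpa [one_add_one_eq_two] using hρ _ hx
  obtain ⟨u, hu, -, -, f', hf', hf'c⟩ :=
    (contDiffWithinAt_succ_iff_hasFDerivWithinAt' (by simp)).1 h2
  have h1 : ContDiffWithinAt ℝ (0 + 1) f' S (z₀, z₀) := by simpa using hf'c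
  obtain ⟨u₂, hu₂, -, -, f'', hf'', hf''c⟩ :=
    (contDiffWithinAt_succ_iff_hasFDerivWithinAt' (by simp)).1 h1
  rw [Set.insert_eq_of_mem hx] at hu hu₂
  have hslice : ∀ w ∈ U ∩ F, ∀ z ∈ U, ∀ {G : Type} [NormedAddCommGroup G] [NormedSpace ℝ G]
      (g : CSpace n × CSpace n → G) (g' : CSpace n × CSpace n →L[ℝ] G),
      HasFDerivWithinAt g g' S (z, w) →
      -- The parameter set need not be open, so derivatives exist only within `S`; in the `z`
      -- variable the slice is the open set `U`, and there they become genuine.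
      HasFDerivAt (fun z => g (z, w)) (g'.comp (ContinuousLinearMap.inl ℝ _ _)) z := by
    intro w hw z hz G _ _ g g' hg
    have h := hg.comp (f := fun z => (z, w)) (s := U) z
      (hasFDerivAt_prodMk_left z w).hasFDerivWithinAt (fun y hy => ⟨hy, hw⟩)
    exact h.hasFDerivAt (hU.mem_nhds hz)
  have hd₀ := hslice z₀ hz₀ z₀ hz₀.1 _ _ (hf' _ (mem_of_mem_nhdsWithin hx hu))
  rw [show (fun z => ρ z z₀) = fun z => (fun p : CSpace n × CSpace n => ρ p.1 p.2) (z, z₀) from rfl,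
    hd₀.fderiv] at hne
  obtain ⟨ν, hν⟩ : ∃ ν, 0 < f' (z₀, z₀) (ν, 0) := by
    obtain ⟨ν, hν⟩ : ∃ ν, f' (z₀, z₀) (ν, 0) ≠ 0 := by
      by_contra! hall
      exact hne (by ext x; simpa using hall x)
    rcases hν.lt_or_gt with h | h
    · refine ⟨-ν, ?_⟩
      have : ((-ν, 0) : CSpace n × CSpace n) = -(ν, 0) := by simp
      rw [this, map_neg]; linarith
    · exact ⟨ν, h⟩
  set D₁ : CSpace n × CSpace n → (CSpace n →L[ℝ] ℝ) :=
    fun y => (f' y).comp (ContinuousLinearMap.inl ℝ _ _) with hD₁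
  set Φ := (ContinuousLinearMap.compL ℝ (CSpace n) (CSpace n × CSpace n) ℝ).flip
    (ContinuousLinearMap.inl ℝ _ _) with hΦ
  set D₂ : CSpace n × CSpace n → (CSpace n →L[ℝ] CSpace n →L[ℝ] ℝ) :=
    fun y => (Φ.comp (f'' y)).comp (ContinuousLinearMap.inl ℝ _ _) with hD₂
  have c1 : ContinuousWithinAt D₁ S (z₀, z₀) :=
    ((ContinuousLinearMap.continuous Φ).continuousAt).comp_continuousWithinAt
      hf'c.continuousWithinAt
  have c2 : ContinuousWithinAt D₂ S (z₀, z₀) := by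
    have h3 := hf''c.continuousWithinAt
    exact (continuousWithinAt_const.clm_comp h3).clm_comp continuousWithinAt_const
  have e1 : ∀ᶠ y in 𝓝[S] (z₀, z₀), ‖D₁ y‖ < ‖D₁ (z₀, z₀)‖ + 1 :=
    c1.norm.eventually (gt_mem_nhds (lt_add_one _))
  have e2 : ∀ᶠ y in 𝓝[S] (z₀, z₀), ‖D₂ y‖ < ‖D₂ (z₀, z₀)‖ + 1 :=
    ((continuous_norm (E := CSpace n →L[ℝ] CSpace n →L[ℝ] ℝ)).continuousAt.comp_continuousWithinAt
      c2).eventually (gt_mem_nhds (lt_add_one _))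
  have e3 : ∀ᶠ y in 𝓝[S] (z₀, z₀), f' (z₀, z₀) (ν, 0) / 2 < D₁ y ν :=
    (c1.clm_apply continuousWithinAt_const).eventually
      (lt_mem_nhds (by simpa [hD₁] using half_lt_self hν))
  have hall := (((e1.and e2).and e3).and (eventually_mem_set.2 hu)).and (eventually_mem_set.2 hu₂)
  obtain ⟨r₁, hr₁, hball⟩ := Metric.mem_nhdsWithin_iff.1 hall
  obtain ⟨r₂, hr₂, hballU⟩ := Metric.isOpen_iff.1 hU z₀ hz₀.1
  have hsub : ball z₀ (min r₁ r₂) ⊆ U := (ball_subset_ball (min_le_right _ _)).trans hballU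
  refine ⟨min r₁ r₂, f' (z₀, z₀) (ν, 0) / 2, ‖D₁ (z₀, z₀)‖ + 1, ‖D₂ (z₀, z₀)‖ + 1, ν,
    lt_min hr₁ hr₂, half_pos hν, by positivity, hsub, fun w hw => ?_⟩
  have hwU : w ∈ U ∩ F := ⟨hsub hw.1, hw.2⟩
  have key : ∀ z ∈ ball z₀ (min r₁ r₂), (((‖D₁ (z, w)‖ < ‖D₁ (z₀, z₀)‖ + 1 ∧
      ‖D₂ (z, w)‖ < ‖D₂ (z₀, z₀)‖ + 1) ∧ f' (z₀, z₀) (ν, 0) / 2 < D₁ (z, w) ν) ∧ (z, w) ∈ u) ∧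
      (z, w) ∈ u₂ := by
    intro z hz
    refine hball ⟨?_, hsub hz, hwU⟩
    rw [← ball_prod_same]
    exact ⟨ball_subset_ball (min_le_left _ _) hz, ball_subset_ball (min_le_left _ _) hw.1⟩
  have d1 : ∀ z ∈ ball z₀ (min r₁ r₂), HasFDerivAt (fun z => ρ z w) (D₁ (z, w)) z :=
    fun z hz => hslice w hwU z (hsub hz) _ _ (hf' _ (key z hz).1.2)
  have d1' : ∀ z ∈ ball z₀ (min r₁ r₂),
      fderiv ℝ (fun z => ρ z w) =ᶠ[𝓝 z] fun z => D₁ (z, w) := by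
    intro z hz
    filter_upwards [isOpen_ball.mem_nhds hz] with y hy using (d1 y hy).fderiv
  have d2 : ∀ z ∈ ball z₀ (min r₁ r₂),
      HasFDerivAt (fderiv ℝ (fun z => ρ z w)) (D₂ (z, w)) z := by
    intro z hz
    have h3 := hslice w hwU z (hsub hz) _ _ (hf'' _ (key z hz).2)
    exact ((ContinuousLinearMap.hasFDerivAt Φ).comp z h3).congr_of_eventuallyEq (d1' z hz)
  refine ⟨fun z hz => (d1 z hz).differentiableAt, fun z hz => (d2 z hz).differentiableAt, ?_, ?_, ?_⟩
  · intro z hz; rw [(d1 z hz).fderiv]; exact (key z hz).1.1.2.le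
  · intro z hz; rw [(d1 z hz).fderiv]; exact (key z hz).1.1.1.1.le
  · intro z hz; rw [(d2 z hz).fderiv]; exact (key z hz).1.1.1.2.le

/-! ### Existence and Lipschitz bounds for the depth near `z₀` -/

namespace IsTransverseOn

variable {n : ℕ} {R : CSpace n → ℝ} {ν z₀ : CSpace n} {r N C M ε : ℝ}

/-- Points of the small ball are within `2ε` of a zero `w`, so `|R| ≤ 2Cε` and a displacement
`2Cε/N` along `ν` suffices to reach a zero. The margin condition keeps such moves in the large ball.
-/
lemma add_smul_mem_ball (hεr : ε + 2 * C * ε / N * ‖ν‖ < r) {z : CSpace n} (hz : z ∈ ball z₀ ε)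
    {τ : ℝ} (hτ : |τ| ≤ 2 * C * ε / N) : z + τ • ν ∈ ball z₀ r := by
  rw [mem_ball_iff_norm] at *
  calc ‖z + τ • ν - z₀‖ = ‖(z - z₀) + τ • ν‖ := by congr 1; abel
    _ ≤ ‖z - z₀‖ + |τ| * ‖ν‖ := (norm_add_le _ _).trans (by rw [norm_smul, Real.norm_eq_abs])
    _ ≤ ε + 2 * C * ε / N * ‖ν‖ := by gcongr
    _ < r := hεr

lemma mem_ball_of_margin (hN : 0 < N) (hC : 0 ≤ C) (hε : 0 < ε)
    (hεr : ε + 2 * C * ε / N * ‖ν‖ < r) {z : CSpace n} (hz : z ∈ ball z₀ ε) : z ∈ ball z₀ r := by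
  simpa using add_smul_mem_ball hεr hz (τ := 0) (by rw [abs_zero]; positivity)

lemma abs_apply_le (h : IsTransverseOn R (ball z₀ r) ν N C M) (hN : 0 < N) (hC : 0 ≤ C)
    (hε : 0 < ε) (hεr : ε + 2 * C * ε / N * ‖ν‖ < r) {w z : CSpace n} (hw : w ∈ ball z₀ ε)
    (hRw : R w = 0) (hz : z ∈ ball z₀ ε) : |R z| ≤ 2 * C * ε := by
  have h1 := h.abs_sub_le (convex_ball z₀ r) (mem_ball_of_margin hN hC hε hεr hz)
    (mem_ball_of_margin hN hC hε hεr hw)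
  rw [hRw, sub_zero] at h1
  have h2 : ‖z - w‖ ≤ 2 * ε := by
    have := dist_triangle_right z w z₀
    rw [dist_eq_norm] at this
    linarith [mem_ball.1 hz, mem_ball.1 hw]
  nlinarith

/-- Moving by `±T` changes `R` by at least `NT = 2Cε ≥ |R z|`, so `R` changes sign on `[-T, T]`. -/
lemma reaches_of_mem_ball (h : IsTransverseOn R (ball z₀ r) ν N C M) (hN : 0 < N) (hC : 0 ≤ C)
    (hε : 0 < ε) (hεr : ε + 2 * C * ε / N * ‖ν‖ < r) {w z : CSpace n} (hw : w ∈ ball z₀ ε)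
    (hRw : R w = 0) (hz : z ∈ ball z₀ ε) : Reaches R (ball z₀ r) ν z := by
  set T := 2 * C * ε / N with hT
  have hT0 : 0 ≤ T := by positivity
  have hNT : N * T = 2 * C * ε := by rw [hT]; field_simp
  have hmem : ∀ τ ∈ Set.Icc (-T) T, z + τ • ν ∈ ball z₀ r :=
    fun τ hτ => add_smul_mem_ball hεr hz (abs_le.2 hτ)
  have hcont : ContinuousOn (fun τ : ℝ => R (z + τ • ν)) (Set.Icc (-T) T) := by
    intro τ hτ
    exact (ContinuousAt.comp (f := fun τ : ℝ => z + τ • ν)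
      (h.differentiableAt _ (hmem τ hτ)).continuousAt (by fun_prop)).continuousWithinAt
  have hz0 : z + (0 : ℝ) • ν ∈ ball z₀ r := hmem 0 (by constructor <;> linarith)
  have hR := abs_le.1 (h.abs_apply_le hN hC hε hεr hw hRw hz)
  have up := h.mul_sub_le (convex_ball z₀ r) hz0 (hmem T (by constructor <;> linarith)) hT0
  have lo := h.mul_sub_le (convex_ball z₀ r) (hmem (-T) (by constructor <;> linarith)) hz0
    (by linarith)
  simp only [zero_smul, add_zero, sub_zero, zero_sub, neg_neg] at up lo
  obtain ⟨τ, hτ, h0⟩ := intermediate_value_Icc (by linarith) hcont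
    (show (0 : ℝ) ∈ Set.Icc _ _ from ⟨by linarith [hR.2], by linarith [hR.1]⟩)
  exact ⟨τ, hmem τ hτ, h0⟩

lemma abs_depthAlong_le (h : IsTransverseOn R (ball z₀ r) ν N C M) (hN : 0 < N) (hC : 0 ≤ C)
    (hε : 0 < ε) (hεr : ε + 2 * C * ε / N * ‖ν‖ < r) {w z : CSpace n} (hw : w ∈ ball z₀ ε)
    (hRw : R w = 0) (hz : z ∈ ball z₀ ε) :
    |depthAlong R (ball z₀ r) ν z| ≤ 2 * C * ε / N := by
  have hr := h.reaches_of_mem_ball hN hC hε hεr hw hRw hz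
  have h1 := h.mul_abs_le (convex_ball z₀ r) (depthAlong_mem hr)
    (mem_ball_of_margin hN hC hε hεr hz)
  rw [apply_depthAlong hr, zero_sub, abs_neg] at h1
  rw [le_div_iff₀ hN]
  linarith [h.abs_apply_le hN hC hε hεr hw hRw hz]

lemma abs_depthAlong_sub_le (h : IsTransverseOn R (ball z₀ r) ν N C M) (hN : 0 < N) (hC : 0 ≤ C)
    (hε : 0 < ε) (hεr : ε + 2 * C * ε / N * ‖ν‖ < r) {w z z' : CSpace n} (hw : w ∈ ball z₀ ε)
    (hRw : R w = 0) (hz : z ∈ ball z₀ ε) (hz' : z' ∈ ball z₀ ε) :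
    |depthAlong R (ball z₀ r) ν z - depthAlong R (ball z₀ r) ν z'| ≤ C / N * ‖z - z'‖ := by
  have h1 := h.mul_abs_depthAlong_sub_le (convex_ball z₀ r)
    (h.reaches_of_mem_ball hN hC hε hεr hw hRw hz) (h.reaches_of_mem_ball hN hC hε hεr hw hRw hz')
    (add_smul_mem_ball hεr hz' (h.abs_depthAlong_le hN hC hε hεr hw hRw hz))
  rw [div_mul_eq_mul_div, le_div_iff₀ hN]
  linarith

lemma continuousOn_depthAlong (h : IsTransverseOn R (ball z₀ r) ν N C M) (hN : 0 < N) (hC : 0 ≤ C)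
    (hε : 0 < ε) (hεr : ε + 2 * C * ε / N * ‖ν‖ < r) {w : CSpace n} (hw : w ∈ ball z₀ ε)
    (hRw : R w = 0) : ContinuousOn (depthAlong R (ball z₀ r) ν) (ball z₀ ε) := by
  refine (LipschitzOnWith.of_dist_le_mul (K := ⟨C / N, by positivity⟩) fun z hz z' hz' => ?_).continuousOn
  rw [Real.dist_eq, dist_eq_norm]
  exact h.abs_depthAlong_sub_le hN hC hε hεr hw hRw hz hz'

end IsTransverseOn

lemma abs_exp_neg_sub_le {x y : ℝ} (hx : 0 ≤ x) (hy : 0 ≤ y) :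
    |Real.exp (-x) - Real.exp (-y)| ≤ |x - y| := by
  have key : ∀ {x y : ℝ}, 0 ≤ x → x ≤ y → |Real.exp (-x) - Real.exp (-y)| ≤ |x - y| := by
    intro x y hx hxy
    have h1 : Real.exp (-y) ≤ Real.exp (-x) := Real.exp_le_exp.2 (by linarith)
    rw [abs_of_nonneg (by linarith), abs_of_nonpos (by linarith)]
    have h2 := Real.add_one_le_exp (x - y)
    have h3 : Real.exp (-y) = Real.exp (-x) * Real.exp (x - y) := by rw [← Real.exp_add]; ring_nf
    have h4 : Real.exp (-x) ≤ 1 := Real.exp_le_one_iff.2 (by linarith)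
    rw [h3]
    nlinarith [Real.exp_pos (-x)]
  rcases le_total x y with h | h
  · exact key hx h
  · rw [abs_sub_comm, abs_sub_comm x]; exact key hy h

/-- Product estimate: a `C/N`-Lipschitz depth times a weight at most `1`, plus a depth at most
`2C/N` times a weight that is `2L`-Lipschitz since `ε ≤ 1`. -/
lemma weightedDepth_lipschitz {n : ℕ} {R : CSpace n → ℝ} {ν z₀ : CSpace n} {r N C M ε L : ℝ}
    (h : IsTransverseOn R (ball z₀ r) ν N C M) (hN : 0 < N) (hC : 0 ≤ C)
    (hε : 0 < ε) (hε1 : ε ≤ 1) (hL : 0 ≤ L) (hεr : ε + 2 * C * ε / N * ‖ν‖ < r)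
    {w z z' : CSpace n} (hw : w ∈ ball z₀ ε) (hRw : R w = 0) (hz : z ∈ ball z₀ ε)
    (hz' : z' ∈ ball z₀ ε) :
    |weightedDepth R (ball z₀ r) ν z₀ L z - weightedDepth R (ball z₀ r) ν z₀ L z'|
      ≤ (C / N + 2 * C / N * (L * 2)) * ‖z - z'‖ := by
  have h1 := h.abs_depthAlong_sub_le hN hC hε hεr hw hRw hz hz'
  have h2 : |depthAlong R (ball z₀ r) ν z'| ≤ 2 * C / N := by
    refine (h.abs_depthAlong_le hN hC hε hεr hw hRw hz').trans ?_
    exact div_le_div_of_nonneg_right (by nlinarith) hN.le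
  rw [weightedDepth, weightedDepth]
  set d := depthAlong R (ball z₀ r) ν z
  set d' := depthAlong R (ball z₀ r) ν z'
  rw [mem_ball_iff_norm] at hz hz'
  have h3 : |L * ‖z - z₀‖ ^ 2 - L * ‖z' - z₀‖ ^ 2| ≤ L * 2 * ‖z - z'‖ := by
    have e : L * ‖z - z₀‖ ^ 2 - L * ‖z' - z₀‖ ^ 2
      = L * (‖z - z₀‖ + ‖z' - z₀‖) * (‖z - z₀‖ - ‖z' - z₀‖) := by ring
    have h4 : |‖z - z₀‖ - ‖z' - z₀‖| ≤ ‖z - z'‖ := by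
      refine (abs_norm_sub_norm_le _ _).trans ?_
      rw [sub_sub_sub_cancel_right]
    rw [e, abs_mul, abs_of_nonneg (by positivity)]
    gcongr
    linarith
  have h4 := (abs_exp_neg_sub_le (by positivity) (by positivity)).trans h3
  have h5 : Real.exp (-(L * ‖z - z₀‖ ^ 2)) ≤ 1 :=
    Real.exp_le_one_iff.2 (neg_nonpos.2 (by positivity))
  set E := Real.exp (-(L * ‖z - z₀‖ ^ 2))
  set E' := Real.exp (-(L * ‖z' - z₀‖ ^ 2))
  have hE : 0 ≤ E := (Real.exp_pos _).le
  calc |d * E - d' * E'| = |(d - d') * E + d' * (E - E')| := by congr 1; ring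
    _ ≤ |d - d'| * |E| + |d'| * |E - E'| := by
      refine (abs_add_le _ _).trans ?_; rw [abs_mul, abs_mul]
    _ ≤ C / N * ‖z - z'‖ * 1 + 2 * C / N * (L * 2 * ‖z - z'‖) := by
      rw [abs_of_nonneg hE]; gcongr
    _ = _ := by ring

/-- The power `η ≤ 1` is subadditive, hence `η`-Hölder with constant one. -/
lemma abs_rpow_sub_rpow_le {x y η : ℝ} (hx : 0 ≤ x) (hy : 0 ≤ y) (hη₀ : 0 ≤ η) (hη₁ : η ≤ 1) :
    |x ^ η - y ^ η| ≤ |x - y| ^ η := by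
  have key : ∀ {x y : ℝ}, 0 ≤ x → x ≤ y → |x ^ η - y ^ η| ≤ |x - y| ^ η := by
    intro x y hx hxy
    have h1 : x ^ η ≤ y ^ η := by gcongr
    have h2 := Real.rpow_add_le_add_rpow hx (sub_nonneg.2 hxy) hη₀ hη₁
    rw [add_sub_cancel] at h2
    rw [abs_sub_comm, abs_sub_comm x, abs_of_nonneg (by linarith), abs_of_nonneg (by linarith)]
    linarith
  rcases le_total x y with h | h
  · exact key hx h
  · rw [abs_sub_comm, abs_sub_comm x]; exact key hy h

/-- Both sides are continuous in `z` away from `w`, and every point of `V ∩ closure Ω` is a limit of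
points of `V ∩ Ω`. -/
lemma IsBumpingFamily.le_neg_bumpG {n : ℕ} {Ω U V : Set (CSpace n)} {z₀ : CSpace n} {f : ℝ → ℝ}
    {γ : ℝ} {ρ : CSpace n → CSpace n → ℝ} (hρ : IsBumpingFamily Ω z₀ f γ U ρ)
    (hf : IsRateFunction f) (hV : IsOpen V) (hVU : V ⊆ U)
    (hVG : ∀ z ∈ V, ∀ w ∈ V, dist z w * gRate f 1 < γ) {w z : CSpace n} (hw : w ∈ V ∩ frontier Ω)
    (hz : z ∈ V ∩ closure Ω) (hzw : z ≠ w) : ρ z w ≤ -bumpG f γ (dist z w) := by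
  have hwU : w ∈ U ∩ frontier Ω := ⟨hVU hw.1, hw.2⟩
  have hcl : z ∈ closure (V ∩ Ω) := hV.inter_closure hz
  have hcont : ContinuousAt (fun z => ρ z w) z := by
    have h1 : ContinuousOn (fun z => ρ z w) U :=
      hρ.contDiff.continuousOn.comp (f := fun z => (z, w)) (by fun_prop) fun y hy => ⟨hy, hwU⟩
    exact h1.continuousAt (hρ.isOpen.mem_nhds (hVU hz.1))
  have hG : ContinuousAt (fun z => -bumpG f γ (dist z w)) z :=
    (ContinuousAt.comp (f := fun z => dist z w)
      (hf.bumpG_continuousAt (dist_pos.2 hzw) (hVG z hz.1 w hw.1)) (by fun_prop)).neg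
  exact ContinuousWithinAt.closure_le hcl hcont.continuousWithinAt hG.continuousWithinAt
    fun y hy => hρ.upper y ⟨hVU hy.1, hy.2⟩ w hwU ⟨dist_nonneg, (hVG y hy.1 w hw.1).le⟩

/-! ### Choice of the neighbourhood and the constants; conclusion -/

theorem theorem3p1 {n : ℕ} (Ω : Set (CSpace n)) (hΩ : IsPseudoconvexC2Domain Ω)
    (z₀ : CSpace n) (hz₀ : z₀ ∈ frontier Ω)
    (f : ℝ → ℝ) (hf : IsRateFunction f) (γ : ℝ) (hγ : 0 < γ)
    (U : Set (CSpace n)) (ρ : CSpace n → CSpace n → ℝ)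
    (hρ : IsBumpingFamily Ω z₀ f γ U ρ)
    (η : ℝ) (hη₀ : 0 < η) (hη₁ : η < 1) :
    ∃ V : Set (CSpace n), IsOpen V ∧ z₀ ∈ V ∧ V ⊆ U ∧
    (∀ z ∈ V, ∀ w ∈ V, InDomG f γ (dist z w)) ∧
    (∀ w ∈ V ∩ frontier Ω, ∀ z ∈ V ∩ closure Ω, z ≠ w → ρ z w < 0) ∧
    ∃ (C : ℝ) (ψ : CSpace n → CSpace n → ℝ), 0 < C ∧
      (∀ w ∈ V ∩ frontier Ω,
        IsPlurisubharmonicOn (ψ w) {z | z ∈ V ∧ ρ z w < 0} ∧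
        (∀ z ∈ V ∩ closure Ω, ∀ z' ∈ V ∩ closure Ω,
          |ψ w z - ψ w z'| ≤ C * dist z z' ^ η) ∧
        (∀ z ∈ V ∩ closure Ω, ψ w z ≤ -(bumpG f γ (dist z w)) ^ η)) ∧
      (∀ z ∈ V ∩ closure Ω, ∀ p, IsBoundaryProj Ω z p →
        p ∈ V ∧ -(C * boundaryDist Ω z ^ η) ≤ ψ p z) := by
  
  set F := frontier Ω with hF
  have hdiag : fderiv ℝ (fun z => ρ z z₀) z₀ ≠ 0 := by
    obtain ⟨c, C, hc, -, hcC⟩ := hρ.grad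
    intro h0
    have := (hcC z₀ ⟨hρ.mem, hz₀⟩ z₀ hρ.mem (hρ.diag z₀ ⟨hρ.mem, hz₀⟩)).1
    rw [h0, norm_zero] at this
    linarith
  obtain ⟨r, N, C, M, ν, hr, hN, hC, hball, htr⟩ :=
    exists_isTransverseOn hρ.isOpen ⟨hρ.mem, hz₀⟩ hρ.contDiff hdiag
  obtain ⟨C₃, hC₃, hlower⟩ := hρ.lower
  obtain ⟨L, hL⟩ : ∃ L, L = 1 + (12 * M * ‖ν‖ * (1 + 4 * C * ‖ν‖ / N) / N) ^ 2 / (1 - η) :=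
    ⟨_, rfl⟩
  have hη : 0 < 1 - η := by linarith
  have hL0 : 0 < L := by rw [hL]; positivity
  obtain ⟨ε, hε, hε1, hεr, hεγ, hεL⟩ : ∃ ε : ℝ, 0 < ε ∧ ε ≤ 1 ∧ ε + 2 * C * ε / N * ‖ν‖ < r ∧
      2 * ε * gRate f 1 < γ ∧ 16 * L ^ 2 * ε ^ 2 ≤ 1 - η := by
    have ev : ∀ (φ : ℝ → ℝ) (c : ℝ), Continuous φ → φ 0 < c → ∀ᶠ ε in 𝓝[>] (0 : ℝ), φ ε < c :=
      fun φ c hφ hc => (hφ.tendsto 0).mono_left nhdsWithin_le_nhds |>.eventually (gt_mem_nhds hc)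
    obtain ⟨ε, ⟨⟨⟨h1, h2⟩, h3⟩, h4⟩, h5⟩ := ((((eventually_mem_nhdsWithin (a := (0 : ℝ))
        (s := Set.Ioi 0)).and (ev (fun ε => ε) 1 (by fun_prop) zero_lt_one)).and
      (ev (fun ε => ε + 2 * C * ε / N * ‖ν‖) r (by fun_prop) (by simpa using hr))).and
      (ev (fun ε => 2 * ε * gRate f 1) γ (by fun_prop) (by simpa using hγ))).and
      (ev (fun ε => 16 * L ^ 2 * ε ^ 2) (1 - η) (by fun_prop) (by simpa using hη))
      |>.exists
    exact ⟨ε, h1, h2.le, h3, h4, h5.le⟩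
  -- A ball would not contain the projections of its points. If `p` is a projection of `z`, then
  -- `dist p z₀` is at most the quantity bounded here, and `p` is at distance zero from the
  -- boundary.
  set V : Set (CSpace n) := {z | dist z z₀ + Metric.infDist z F < ε} with hV
  have hVo : IsOpen V := isOpen_lt (by fun_prop) continuous_const
  have hVball : V ⊆ ball z₀ ε := fun z hz => by
    have hz' : dist z z₀ + Metric.infDist z F < ε := hz
    exact mem_ball.2 (by linarith [Metric.infDist_nonneg (x := z) (s := F)])
  have hVr : V ⊆ ball z₀ r := fun z hz =>
    IsTransverseOn.mem_ball_of_margin hN hC hε hεr (hVball hz)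
  have hVU : V ⊆ U := hVr.trans hball
  have hVG : ∀ z ∈ V, ∀ w ∈ V, dist z w * gRate f 1 < γ := by
    intro z hz w hw
    refine lt_of_le_of_lt ?_ hεγ
    have h1 := hf.gRate_pos le_rfl
    have h2 := dist_triangle_right z w z₀
    have h3 := mem_ball.1 (hVball hz)
    have h4 := mem_ball.1 (hVball hw)
    gcongr
    linarith
  have hz₀V : z₀ ∈ V := by
    show dist z₀ z₀ + Metric.infDist z₀ F < ε
    rw [dist_self, Metric.infDist_zero_of_mem hz₀, add_zero]; exact hε
  have hGle : ∀ w ∈ V ∩ F, ∀ z ∈ V ∩ closure Ω, z ≠ w → ρ z w ≤ -bumpG f γ (dist z w) :=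
    fun w hw z hz hzw => hρ.le_neg_bumpG hf hVo hVU hVG hw hz hzw
  have hneg : ∀ w ∈ V ∩ F, ∀ z ∈ V ∩ closure Ω, z ≠ w → ρ z w < 0 := by
    intro w hw z hz hzw
    have := hf.bumpG_pos (dist_pos.2 hzw) (hVG z hz.1 w hw.1)
    linarith [hGle w hw z hz hzw]
  have hRw : ∀ w ∈ V ∩ F, ρ w w = 0 := fun w hw => hρ.diag w ⟨hVU hw.1, hw.2⟩
  have hnonpos : ∀ w ∈ V ∩ F, ∀ z ∈ V ∩ closure Ω, ρ z w ≤ 0 := by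
    intro w hw z hz
    rcases eq_or_ne z w with rfl | hzw
    · exact (hRw z hw).le
    · exact (hneg w hw z hz hzw).le
  have hcx : Convex ℝ (ball z₀ r) := convex_ball z₀ r
  have htrV : ∀ w ∈ V ∩ F, IsTransverseOn (fun z => ρ z w) (ball z₀ r) ν N C M :=
    fun w hw => htr w ⟨hVr hw.1, hw.2⟩
  have hreach : ∀ w ∈ V ∩ F, ∀ z ∈ V,
      IsTransverseOn.Reaches (fun z => ρ z w) (ball z₀ r) ν z := fun w hw z hz =>
    (htrV w hw).reaches_of_mem_ball hN hC hε hεr (hVball hw.1) (hRw w hw) (hVball hz)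
  set δ : CSpace n → CSpace n → ℝ := fun w z => depthAlong (fun z => ρ z w) (ball z₀ r) ν z
  set W : CSpace n → CSpace n → ℝ :=
    fun w z => weightedDepth (fun z => ρ z w) (ball z₀ r) ν z₀ L z with hW
  have hδ0 : ∀ w ∈ V ∩ F, ∀ z ∈ V ∩ closure Ω, 0 ≤ δ w z := fun w hw z hz =>
    (htrV w hw).depthAlong_nonneg hcx hN (hreach w hw z hz.1) (hVr hz.1) (hnonpos w hw z hz)
  have hW0 : ∀ w ∈ V ∩ F, ∀ z ∈ V ∩ closure Ω, 0 ≤ W w z := fun w hw z hz =>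
    mul_nonneg (hδ0 w hw z hz) (Real.exp_pos _).le
  -- `C‖ν‖` compares `-ρ` with the depth, and `e^L` undoes the weight on a ball of radius at most
  -- `1`; with `K = A^η` the bound by `G^η` has constant one.
  set A := C * ‖ν‖ * Real.exp L + 1 with hA
  have hA0 : 0 < A := by positivity
  set K := A ^ η with hK
  have hK0 : 0 < K := by positivity
  set Λ := C / N + 2 * C / N * (L * 2) with hΛ
  have hΛ0 : 0 ≤ Λ := by positivity
  have hB1 : 0 ≤ K * Λ ^ η := by positivity
  have hB2 : 0 ≤ K * (C₃ / N) ^ η := by positivity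
  refine ⟨V, hVo, hz₀V, hVU, fun z hz w hw => ⟨dist_nonneg, (hVG z hz w hw).le⟩, hneg,
    K * Λ ^ η + K * (C₃ / N) ^ η + 1, fun w z => -(K * W w z ^ η), by positivity, ?_, ?_⟩
  · intro w hw
    refine ⟨?_, ?_, ?_⟩
    · refine isPlurisubharmonicOn_weightedDepth (htrV w hw) isOpen_ball hcx hN ?_ hη₀ hη₁ hK0 hL
        hεL (fun z hz => hVr hz.1) (fun z hz => hreach w hw z hz.1) (fun z hz => hz.2)
        (fun z hz => ?_) (((htrV w hw).continuousOn_depthAlong hN hC hε hεr (hVball hw.1)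
          (hRw w hw)).mono fun z hz => hVball hz.1)
      · exact fun z hz => hρ.pseudoconvex w ⟨hVU hw.1, hw.2⟩ z (hball hz)
      · exact (mem_ball_iff_norm.1 (hVball hz.1)).le
    · intro z hz z' hz'
      have h1 := abs_rpow_sub_rpow_le (hW0 w hw z hz) (hW0 w hw z' hz') hη₀.le hη₁.le
      have h2 := weightedDepth_lipschitz (htrV w hw) hN hC hε hε1 hL0.le hεr (hVball hw.1)
        (hRw w hw) (hVball hz.1) (hVball hz'.1)
      calc |-(K * W w z ^ η) - -(K * W w z' ^ η)| = K * |W w z ^ η - W w z' ^ η| := by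
            rw [← abs_of_pos hK0, ← abs_mul, abs_of_pos hK0, ← abs_neg]; congr 1; ring
        _ ≤ K * (Λ * dist z z') ^ η := by
            rw [dist_eq_norm]
            refine mul_le_mul_of_nonneg_left (h1.trans ?_) hK0.le
            exact Real.rpow_le_rpow (abs_nonneg _) h2 hη₀.le
        _ = K * Λ ^ η * dist z z' ^ η := by rw [Real.mul_rpow hΛ0 dist_nonneg]; ring
        _ ≤ _ := by gcongr; linarith
    · intro z hz
      refine neg_le_neg ?_
      rcases eq_or_ne z w with rfl | hzw
      · rw [dist_self, bumpG, if_pos rfl, Real.zero_rpow hη₀.ne']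
        exact mul_nonneg hK0.le (Real.rpow_nonneg (hW0 z hw z hz) _)
      · rw [hK, ← Real.mul_rpow hA0.le (hW0 w hw z hz)]
        refine Real.rpow_le_rpow
          (hf.bumpG_pos (dist_pos.2 hzw) (hVG z hz.1 w hw.1)).le ?_ hη₀.le
        have h1 := (htrV w hw).neg_le_mul_depthAlong hcx hN (hreach w hw z hz.1) (hVr hz.1)
          (hnonpos w hw z hz)
        have h2 : 1 ≤ Real.exp L * Real.exp (-(L * ‖z - z₀‖ ^ 2)) := by
          rw [← Real.exp_add]
          refine Real.one_le_exp ?_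
          have h3 : ‖z - z₀‖ ≤ 1 := (mem_ball_iff_norm.1 (hVball hz.1)).le.trans hε1
          have h4 : ‖z - z₀‖ ^ 2 ≤ 1 := pow_le_one₀ (norm_nonneg _) h3
          nlinarith
        calc bumpG f γ (dist z w) ≤ -ρ z w := by linarith [hGle w hw z hz hzw]
          _ ≤ C * ‖ν‖ * δ w z := h1
          _ ≤ C * ‖ν‖ * δ w z * (Real.exp L * Real.exp (-(L * ‖z - z₀‖ ^ 2))) :=
            le_mul_of_one_le_right (mul_nonneg (by positivity) (hδ0 w hw z hz)) h2
          _ = C * ‖ν‖ * Real.exp L * W w z := by simp only [hW, weightedDepth]; ring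
          _ ≤ A * W w z := by
            refine mul_le_mul_of_nonneg_right ?_ (hW0 w hw z hz)
            rw [hA]; linarith
  · intro z hz p hp
    have hzV : dist z z₀ + Metric.infDist z F < ε := hz.1
    have hdist : dist z p = Metric.infDist z F := hp.2
    have hpV : p ∈ V := by
      show dist p z₀ + Metric.infDist p F < ε
      rw [Metric.infDist_zero_of_mem hp.1, add_zero]
      have := dist_triangle_left p z₀ z
      linarith
    refine ⟨hpV, ?_⟩
    have hpF : p ∈ V ∩ F := ⟨hpV, hp.1⟩
    have hb0 : 0 ≤ boundaryDist Ω z := Metric.infDist_nonneg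
    have hlow : -ρ z p ≤ C₃ * boundaryDist Ω z := by
      rcases eq_or_ne z p with rfl | hzp
      · rw [hRw z hpF, neg_zero]; positivity
      -- The lower bound on `ρ` is given only inside `Ω`; a boundary point is its own unique
      -- projection.
      · have hzΩ : z ∈ Ω := by
          by_contra hzn
          have hzF : z ∈ F := by rw [hF, hΩ.isOpen.frontier_eq]; exact ⟨hz.2, hzn⟩
          rw [Metric.infDist_zero_of_mem hzF, dist_eq_zero] at hdist
          exact hzp hdist
        linarith [hlower z ⟨hVU hz.1, hzΩ⟩ p (hVU hpV) hp]
    have h1 := (htrV p hpF).mul_depthAlong_le hcx hN (hreach p hpF z hz.1) (hVr hz.1)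
      (hnonpos p hpF z hz)
    have h2 : W p z ≤ C₃ / N * boundaryDist Ω z := by
      have h3 : W p z ≤ δ p z := mul_le_of_le_one_right (hδ0 p hpF z hz)
        (Real.exp_le_one_iff.2 (neg_nonpos.2 (by positivity)))
      rw [div_mul_eq_mul_div, le_div_iff₀ hN]
      nlinarith
    refine neg_le_neg ?_
    calc K * W p z ^ η ≤ K * (C₃ / N * boundaryDist Ω z) ^ η :=
          mul_le_mul_of_nonneg_left (Real.rpow_le_rpow (hW0 p hpF z hz) h2 hη₀.le) hK0.le
      _ = K * (C₃ / N) ^ η * boundaryDist Ω z ^ η := by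
          rw [Real.mul_rpow (by positivity) hb0]; ring
      _ ≤ _ := by gcongr; linarith
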